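/- Let $A$ be a finite-dimensional complex vector space. For an operator space structure on $A$ (norms $\|\cdot\|_n$ on all $M_n(A)$ satisfying Ruan's axioms $\|x\oplus y\|_{m+n}=\max\{\|x\|_m,\|y\|_n\}$ and $\|\alpha x\beta\|_m\le\|\alpha\|\|x\|_m\|\beta\|$) let $A_c$ denote the conjugate operator space (scalar multiplication $\lambda * a=\overline{\lambda}a$, same matrix norms) and $A_o$ the opposite operator space (same vector space, $\|[x_{ji}]\|_{M_n(A_o)}=\|[x_{ij}]\|_{M_n(A)}$). The Haagerup tensor product $X\otimes_h Y$ is the vector space $X\otimes Y$ with the norms $$\|v\|_h=\inf\{\|x\|\,\|y\| : v=x\odot y,\ x\in M_{n,r}(X),\ y\in M_{r,n}(Y),\ r\in\mathbb N\},\qquad (x\odot y)_{ij}=\sum_k x_{ik}\otimes y_{kj},$$ for $v\in M_n(X\otimes Y)$. Here a rectangular matrix is normed by padding it with zeros to a square matrix. A linear map is a complete contraction (complete isometry) if all its entrywise amplifications to $n\times n$ matrices are contractions (isometries). $\mathbb C$ carries the operator norms of scalar matrices. Consider the following two kinds of structure on $A$. (I) A von Neumann algebra structure in the standard sense: an associative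 bilinear multiplication with a unit $1$, an antilinear involution with $(a^*)^*=a$ and $(ab)^*=b^*a^*$, and a norm with $\|ab\|\le\|a\|\|b\|$ and $\|a^*a\|=\|a\|^2$. Its canonical operator space structure is given by the norms that make each $M_n(A)$, with the induced matrix multiplication, unit and involution, a von Neumann algebra in this sense. (II) An operator space structure on $A$ together with complete contractions $\mu: A\otimes_h A\to A$, $\eta:\mathbb C\to A$ and $i: A_c\to A_o$ such that 1. $(A,\eta,\mu)$ is a monoid object for $\otimes_h$ (with unit object $\mathbb C$) in the category of finite-dimensional operator spaces and complete contractions; 2. $i\circ i=\mathrm{id}_A$ (as maps $A=A_{cc}\to A_{oc}=A_{co}\to A_{oo}=A$); 3. $i\circ\mu=\mu\circ\gamma\circ(i\otimes i)$ as maps $A_c\otimes_h A_c=(A\otimes_h A)_c\to A_o$, where $\gamma: A_o\otimes_h A_o\to(A\otimes_h A)_o$ is the swap $x\otimes y\mapsto y\otimes x$; 4. for every complete isometry $a:\mathbb C\to A$, the composite $$\mathbb C\cong\mathbb C_o\otimes_h\mathbb C_c\xrightarrow{a\otimes a}A_o\otimes_h A_c\xrightarrow{\mathrm{id}\otimes i}A_o\otimes_h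 A_o\xrightarrow{\gamma}(A\otimes_h A)_o\xrightarrow{\mu}A_o$$ is a complete isometry. Say that a structure (I) and a structure (II) on $A$ correspond if $\mu(a\otimes b)=ab$, $\eta(1)=1$, $i(a)=a^*$, the norm of (I) is the norm of (II) on $M_1(A)\cong A$, and the operator space structure of (II) is the canonical one of (I). Theorem. Every structure (I) on $A$ corresponds to exactly one structure (II) on $A$, and every structure (II) on $A$ corresponds to exactly one structure (I) on $A$. -/

import Mathlib

namespace FdOS

noncomputable section

open scoped TensorProduct Matrix
open scoped Matrix.Norms.L2Operator

universe u v

section MatrixOperations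

variable {X : Type u} [AddCommGroup X] [Module ℂ X]
variable {Y : Type v} [AddCommGroup Y] [Module ℂ Y]

/-- The product `α x β` of a scalar matrix, a matrix with entries in `X`, and a scalar matrix. -/
def sandwich {m n p q : ℕ} (α : Matrix (Fin p) (Fin m) ℂ) (x : Matrix (Fin m) (Fin n) X)
    (β : Matrix (Fin n) (Fin q) ℂ) : Matrix (Fin p) (Fin q) X :=
  fun i j => ∑ k, ∑ l, (α i k * β l j) • x k l

/-- The block diagonal matrix `x ⊕ y`. -/
def dsum {Z : Type*} [Zero Z] {m n m' n' : ℕ} (x : Matrix (Fin m) (Fin n) Z)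
    (y : Matrix (Fin m') (Fin n') Z) : Matrix (Fin (m + m')) (Fin (n + n')) Z :=
  Matrix.reindex finSumFinEquiv finSumFinEquiv (Matrix.fromBlocks x 0 0 y)

/-- An `m × n` matrix, padded by zeros to a square matrix of size `max m n`. -/
def pad {Z : Type*} [Zero Z] {m n : ℕ} (x : Matrix (Fin m) (Fin n) Z) :
    Matrix (Fin (max m n)) (Fin (max m n)) Z :=
  fun i j => if h : i.1 < m ∧ j.1 < n then x ⟨i.1, h.1⟩ ⟨j.1, h.2⟩ else 0

/-- The matrix inner product `(x ⊙ y) i j = ∑ k, x i k ⊗ y k j`. -/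
def matrixInner {n r m : ℕ} (x : Matrix (Fin n) (Fin r) X) (y : Matrix (Fin r) (Fin m) Y) :
    Matrix (Fin n) (Fin m) (X ⊗[ℂ] Y) :=
  fun i j => ∑ k, x i k ⊗ₜ[ℂ] y k j

/-! Scalar matrices. -/

theorem opNorm_le_of {m n : ℕ} {α : Matrix (Fin m) (Fin n) ℂ} {C : ℝ} (hC : 0 ≤ C)
    (h : ∀ v : Fin n → ℂ, ∑ i, ‖(α *ᵥ v) i‖ ^ 2 ≤ C ^ 2 * ∑ i, ‖v i‖ ^ 2) : ‖α‖ ≤ C := by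
  rw [Matrix.l2_opNorm_def]
  refine ContinuousLinearMap.opNorm_le_bound _ hC fun v => ?_
  refine abs_le_of_sq_le_sq' ?_ (by positivity) |>.2
  rw [mul_pow, EuclideanSpace.norm_sq_eq, EuclideanSpace.norm_sq_eq]
  simpa using h v.ofLp

theorem sq_mulVec_le {m n : ℕ} (α : Matrix (Fin m) (Fin n) ℂ) (v : Fin n → ℂ) :
    ∑ i, ‖(α *ᵥ v) i‖ ^ 2 ≤ ‖α‖ ^ 2 * ∑ i, ‖v i‖ ^ 2 := by
  have h := Matrix.l2_opNorm_mulVec α (WithLp.toLp 2 v)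
  have h2 := pow_le_pow_left₀ (norm_nonneg _) h 2
  rw [mul_pow, EuclideanSpace.norm_sq_eq, EuclideanSpace.norm_sq_eq] at h2
  simpa using h2

theorem norm_map_star_le {m n : ℕ} (α : Matrix (Fin m) (Fin n) ℂ) : ‖α.map star‖ ≤ ‖α‖ := by
  refine opNorm_le_of (norm_nonneg _) fun v => ?_
  have h := sq_mulVec_le α (star v)
  have e : ∀ i, ‖(α.map star *ᵥ v) i‖ = ‖(α *ᵥ star v) i‖ := fun i => by
    rw [← norm_star ((α *ᵥ star v) i)]
    simp [Matrix.mulVec, dotProduct, star_sum]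
  calc _ = ∑ i, ‖(α *ᵥ star v) i‖ ^ 2 := Finset.sum_congr rfl fun i _ => by rw [e]
    _ ≤ _ := by simpa using h

theorem norm_map_star {m n : ℕ} (α : Matrix (Fin m) (Fin n) ℂ) : ‖α.map star‖ = ‖α‖ := by
  refine le_antisymm (norm_map_star_le α) ?_
  have := norm_map_star_le (α.map star)
  have e : (α.map star).map star = α := by
    ext i j
    simp
  rwa [e] at this

theorem norm_transpose {m n : ℕ} (α : Matrix (Fin m) (Fin n) ℂ) : ‖αᵀ‖ = ‖α‖ := by
  rw [← norm_map_star αᵀ]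
  exact Matrix.l2_opNorm_conjTranspose α

theorem norm_one_le (n : ℕ) : ‖(1 : Matrix (Fin n) (Fin n) ℂ)‖ ≤ 1 :=
  opNorm_le_of zero_le_one fun v => by simp

theorem norm_dsum_le {m n m' n' : ℕ} (α : Matrix (Fin m) (Fin n) ℂ)
    (β : Matrix (Fin m') (Fin n') ℂ) : ‖dsum α β‖ ≤ max ‖α‖ ‖β‖ := by
  have h0 : 0 ≤ max ‖α‖ ‖β‖ := le_max_of_le_left (norm_nonneg _)
  refine opNorm_le_of h0 fun v => ?_
  have e1 : ∀ i : Fin m, (dsum α β *ᵥ v) (Fin.castAdd m' i)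
      = (α *ᵥ fun j => v (Fin.castAdd n' j)) i := fun i => by
    simp [dsum, Matrix.mulVec, dotProduct, Fin.sum_univ_add]
  have e2 : ∀ i : Fin m', (dsum α β *ᵥ v) (Fin.natAdd m i)
      = (β *ᵥ fun j => v (Fin.natAdd n j)) i := fun i => by
    simp [dsum, Matrix.mulVec, dotProduct, Fin.sum_univ_add]
  rw [Fin.sum_univ_add, Fin.sum_univ_add (fun i => ‖v i‖ ^ 2), mul_add]
  simp only [e1, e2]
  refine add_le_add ((sq_mulVec_le α _).trans ?_) ((sq_mulVec_le β _).trans ?_)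
  · gcongr
    exact le_max_left _ _
  · gcongr
    exact le_max_right _ _

/-- The `0/1` matrix of a map of indices. -/
def incl {n N : ℕ} (f : Fin n → Fin N) : Matrix (Fin N) (Fin n) ℂ :=
  (1 : Matrix (Fin N) (Fin N) ℂ).submatrix id f

theorem incl_apply {n N : ℕ} (f : Fin n → Fin N) (i : Fin N) (j : Fin n) :
    incl f i j = if i = f j then 1 else 0 := by
  simp [incl, Matrix.one_apply]

theorem incl_transpose_mul {n N : ℕ} {f : Fin n → Fin N} (hf : f.Injective) :
    (incl f)ᵀ * incl f = 1 := by
  ext i j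
  simp [Matrix.mul_apply, incl_apply, Matrix.one_apply, hf.eq_iff, eq_comm]

theorem norm_incl_le {n N : ℕ} {f : Fin n → Fin N} (hf : f.Injective) : ‖incl f‖ ≤ 1 := by
  have h : (incl f)ᴴ = (incl f)ᵀ := by
    ext i j
    simp [incl_apply, apply_ite]
  have h1 := Matrix.l2_opNorm_conjTranspose_mul_self (incl f)
  rw [h, incl_transpose_mul hf] at h1
  have h2 := norm_one_le n
  nlinarith [norm_nonneg (incl f)]

theorem norm_incl_transpose_le {n N : ℕ} {f : Fin n → Fin N} (hf : f.Injective) :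
    ‖(incl f)ᵀ‖ ≤ 1 := by
  rw [norm_transpose]
  exact norm_incl_le hf

/-! Algebra of `sandwich`, `dsum`, `pad`, `matrixInner`. -/

theorem sum_comm₄ {M : Type*} [AddCommMonoid M] {a b c d : ℕ}
    (f : Fin a → Fin b → Fin c → Fin d → M) :
    ∑ i, ∑ j, ∑ k, ∑ l, f i j k l = ∑ k, ∑ l, ∑ j, ∑ i, f i j k l := by
  have h := Finset.sum_comm (s := (Finset.univ : Finset (Fin a × Fin b)))
    (t := (Finset.univ : Finset (Fin c × Fin d))) (f := fun p q => f p.1 p.2 q.1 q.2)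
  simp only [Fintype.sum_prod_type] at h
  rw [h]
  exact Finset.sum_congr rfl fun k _ => Finset.sum_congr rfl fun l _ => Finset.sum_comm

theorem sandwich_sandwich {m n p q p' q' : ℕ} (α' : Matrix (Fin p') (Fin p) ℂ)
    (α : Matrix (Fin p) (Fin m) ℂ) (x : Matrix (Fin m) (Fin n) X)
    (β : Matrix (Fin n) (Fin q) ℂ) (β' : Matrix (Fin q) (Fin q') ℂ) :
    sandwich α' (sandwich α x β) β' = sandwich (α' * α) x (β * β') := by
  ext i j
  simp only [sandwich, Matrix.mul_apply, Finset.smul_sum, Finset.sum_mul, Finset.mul_sum,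
    Finset.sum_smul, smul_smul]
  rw [sum_comm₄]
  refine Finset.sum_congr rfl fun k _ => Finset.sum_congr rfl fun l _ =>
    Finset.sum_congr rfl fun k' _ => Finset.sum_congr rfl fun l' _ => ?_
  congr 1
  ring

theorem sandwich_one {m n : ℕ} (x : Matrix (Fin m) (Fin n) X) : sandwich 1 x 1 = x := by
  ext i j
  simp [sandwich, Matrix.one_apply]

theorem sandwich_dsum {m n p q m' n' p' q' : ℕ} (α : Matrix (Fin p) (Fin m) ℂ)
    (x : Matrix (Fin m) (Fin n) X) (β : Matrix (Fin n) (Fin q) ℂ)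
    (α' : Matrix (Fin p') (Fin m') ℂ) (x' : Matrix (Fin m') (Fin n') X)
    (β' : Matrix (Fin n') (Fin q') ℂ) :
    sandwich (dsum α α') (dsum x x') (dsum β β') = dsum (sandwich α x β) (sandwich α' x' β') := by
  ext i j
  induction i using Fin.addCases <;> induction j using Fin.addCases <;>
    simp [sandwich, dsum, Fin.sum_univ_add]

theorem matrixInner_dsum {n r m n' r' m' : ℕ} (x : Matrix (Fin n) (Fin r) X)
    (y : Matrix (Fin r) (Fin m) Y) (x' : Matrix (Fin n') (Fin r') X)
    (y' : Matrix (Fin r') (Fin m') Y) :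
    matrixInner (dsum x x') (dsum y y') = dsum (matrixInner x y) (matrixInner x' y') := by
  ext i j
  induction i using Fin.addCases <;> induction j using Fin.addCases <;>
    simp [matrixInner, dsum, Fin.sum_univ_add]

theorem sandwich_matrixInner {n r m p q : ℕ} (α : Matrix (Fin p) (Fin n) ℂ)
    (x : Matrix (Fin n) (Fin r) X) (y : Matrix (Fin r) (Fin m) Y)
    (β : Matrix (Fin m) (Fin q) ℂ) :
    sandwich α (matrixInner x y) β = matrixInner (sandwich α x (1 : Matrix (Fin r) (Fin r) ℂ))
      (sandwich (1 : Matrix (Fin r) (Fin r) ℂ) y β) := by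
  ext i j
  simp only [sandwich, matrixInner, Matrix.one_apply, Finset.smul_sum, mul_ite, mul_one, mul_zero,
    ite_mul, one_mul, zero_mul, ite_smul, zero_smul, Finset.sum_ite_eq, Finset.sum_ite_eq',
    Finset.mem_univ, if_true, Finset.sum_ite_irrel, Finset.sum_const_zero]
  simp only [TensorProduct.sum_tmul, TensorProduct.tmul_sum, TensorProduct.smul_tmul_smul]
  have h := Finset.sum_comm (s := (Finset.univ : Finset (Fin n × Fin m)))
    (t := (Finset.univ : Finset (Fin r)))
    (f := fun p k => (α i p.1 * β p.2 j) • (x p.1 k ⊗ₜ[ℂ] y k p.2))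
  simp only [Fintype.sum_prod_type] at h
  rw [h]
  exact Finset.sum_congr rfl fun k _ => Finset.sum_comm

theorem sandwich_incl_apply {m n p q : ℕ} (f : Fin m → Fin p) (g : Fin n → Fin q)
    (hf : f.Injective) (hg : g.Injective)
    (x : Matrix (Fin m) (Fin n) X) (i : Fin m) (j : Fin n) :
    sandwich (incl f) x (incl g)ᵀ (f i) (g j) = x i j := by
  simp [sandwich, incl_apply, hf.eq_iff, hg.eq_iff]

theorem sandwich_incl_eq_zero {m n p q : ℕ} (f : Fin m → Fin p) (g : Fin n → Fin q)
    (x : Matrix (Fin m) (Fin n) X) (i : Fin p) (j : Fin q)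
    (h : (∀ k, i ≠ f k) ∨ ∀ l, j ≠ g l) :
    sandwich (incl f) x (incl g)ᵀ i j = 0 := by
  rcases h with h | h <;> simp [sandwich, incl_apply, h]

theorem pad_eq {m n : ℕ} (x : Matrix (Fin m) (Fin n) X) :
    pad x = sandwich (incl (Fin.castLE (le_max_left m n))) x
      (incl (Fin.castLE (le_max_right m n)))ᵀ := by
  ext i j
  by_cases h : i.1 < m ∧ j.1 < n
  · rw [show pad x i j = x ⟨i.1, h.1⟩ ⟨j.1, h.2⟩ from dif_pos h]
    exact (sandwich_incl_apply (Fin.castLE (le_max_left m n)) (Fin.castLE (le_max_right m n))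
      (Fin.castLE_injective _) (Fin.castLE_injective _) x ⟨i.1, h.1⟩ ⟨j.1, h.2⟩).symm
  · rw [show pad x i j = 0 from dif_neg h, sandwich_incl_eq_zero]
    by_contra h'
    push Not at h'
    obtain ⟨⟨k, hk⟩, ⟨l, hl⟩⟩ := h'
    exact h ⟨by rw [hk]; exact k.2, by rw [hl]; exact l.2⟩

theorem sandwich_transpose {m n p q : ℕ} (α : Matrix (Fin p) (Fin m) ℂ)
    (x : Matrix (Fin m) (Fin n) X) (β : Matrix (Fin n) (Fin q) ℂ) :
    (sandwich α x β)ᵀ = sandwich βᵀ xᵀ αᵀ := by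
  ext i j
  simp only [sandwich, Matrix.transpose_apply]
  rw [Finset.sum_comm]
  simp [mul_comm]

theorem dsum_transpose {Z : Type*} [Zero Z] {m n m' n' : ℕ} (x : Matrix (Fin m) (Fin n) Z)
    (y : Matrix (Fin m') (Fin n') Z) : (dsum x y)ᵀ = dsum xᵀ yᵀ := by
  simp [dsum, Matrix.fromBlocks_transpose]

end MatrixOperations

/-- An operator space structure on a (finite-dimensional) complex vector space `X`: a norm on each
`M_n(X)`, i.e. a seminorm that vanishes only at `0`, subject to Ruan's axioms. Here `‖α‖` is the
operator norm of a scalar matrix. Completeness is automatic in finite dimension. -/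
@[ext]
structure OperatorSpaceStructure (X : Type u) [AddCommGroup X] [Module ℂ X] where
  norm : ∀ n : ℕ, Seminorm ℂ (Matrix (Fin n) (Fin n) X)
  eq_zero_of_norm_eq_zero : ∀ (n : ℕ) (x : Matrix (Fin n) (Fin n) X), norm n x = 0 → x = 0
  norm_dsum : ∀ (m n : ℕ) (x : Matrix (Fin m) (Fin m) X) (y : Matrix (Fin n) (Fin n) X),
    norm (m + n) (dsum x y) = max (norm m x) (norm n y)
  norm_sandwich_le : ∀ (m : ℕ) (α : Matrix (Fin m) (Fin m) ℂ) (x : Matrix (Fin m) (Fin m) X)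
    (β : Matrix (Fin m) (Fin m) ℂ), norm m (sandwich α x β) ≤ ‖α‖ * norm m x * ‖β‖

namespace OperatorSpaceStructure

section Basic

variable {X : Type u} [AddCommGroup X] [Module ℂ X] (E : OperatorSpaceStructure X)

/-- The norm of `X`, from the identification of `X` with `M_1(X)`. -/
def groundNorm : Seminorm ℂ X :=
  (E.norm 1).comp
    ({ toFun := fun x _ _ => x
       map_add' := fun _ _ => rfl
       map_smul' := fun _ _ => rfl } : X →ₗ[ℂ] Matrix (Fin 1) (Fin 1) X)

/-- The norm of a rectangular matrix, from the embedding of `M_{m,n}(X)` into `M_p(X)` with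
`p = max m n`. -/
def rectNorm {m n : ℕ} (x : Matrix (Fin m) (Fin n) X) : ℝ := E.norm (max m n) (pad x)

theorem norm_incl {n N : ℕ} (h : n ≤ N) (x : Matrix (Fin n) (Fin n) X) :
    E.norm N (sandwich (incl (Fin.castLE h)) x (incl (Fin.castLE h))ᵀ) = E.norm n x := by
  obtain ⟨k, rfl⟩ := Nat.exists_eq_add_of_le h
  have e : sandwich (incl (Fin.castLE h)) x (incl (Fin.castLE h))ᵀ
      = dsum x (0 : Matrix (Fin k) (Fin k) X) := by
    ext i j
    induction i using Fin.addCases with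
    | left i =>
      induction j using Fin.addCases with
      | left j =>
        refine (sandwich_incl_apply (Fin.castLE h) (Fin.castLE h)
          (Fin.castLE_injective _) (Fin.castLE_injective _) x i j).trans ?_
        simp [dsum]
      | right j =>
        rw [sandwich_incl_eq_zero]
        · simp [dsum]
        · refine Or.inr fun l hl => ?_
          have := congrArg Fin.val hl
          simp at this
          omega
    | right i =>
      rw [sandwich_incl_eq_zero]
      · induction j using Fin.addCases <;> simp [dsum]
      · refine Or.inl fun l hl => ?_
        have := congrArg Fin.val hl
        simp at this
        omega
  rw [e, E.norm_dsum, map_zero]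
  exact max_eq_left (apply_nonneg _ _)

theorem rectNorm_square {n : ℕ} (x : Matrix (Fin n) (Fin n) X) : E.rectNorm x = E.norm n x := by
  rw [rectNorm, pad_eq]
  exact E.norm_incl (le_max_left n n) x

theorem rectNorm_nonneg {m n : ℕ} (x : Matrix (Fin m) (Fin n) X) : 0 ≤ E.rectNorm x :=
  apply_nonneg _ _

theorem mul_norm_mul_le {a b c a' c' : ℝ} (ha : 0 ≤ a) (hb : 0 ≤ b) (hc : 0 ≤ c)
    (haa : a ≤ a') (hcc : c ≤ c') : a * b * c ≤ a' * b * c' := by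
  have : 0 ≤ a' := ha.trans haa
  gcongr

theorem norm_incl_mul_le {n N p : ℕ} {f : Fin n → Fin N} (hf : f.Injective)
    (α : Matrix (Fin n) (Fin p) ℂ) : ‖incl f * α‖ ≤ ‖α‖ :=
  (Matrix.l2_opNorm_mul _ _).trans
    ((mul_le_mul_of_nonneg_right (norm_incl_le hf) (norm_nonneg _)).trans (one_mul _).le)

theorem norm_mul_inclT_le {n N p : ℕ} {f : Fin n → Fin N} (hf : f.Injective)
    (α : Matrix (Fin p) (Fin n) ℂ) : ‖α * (incl f)ᵀ‖ ≤ ‖α‖ :=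
  (Matrix.l2_opNorm_mul _ _).trans
    ((mul_le_mul_of_nonneg_left (norm_incl_transpose_le hf) (norm_nonneg _)).trans (mul_one _).le)

theorem norm_sandwich_le' {m p : ℕ} (α : Matrix (Fin p) (Fin m) ℂ) (x : Matrix (Fin m) (Fin m) X)
    (β : Matrix (Fin m) (Fin p) ℂ) : E.norm p (sandwich α x β) ≤ ‖α‖ * E.norm m x * ‖β‖ := by
  have hp : p ≤ p + m := Nat.le_add_right _ _
  have hm : m ≤ p + m := Nat.le_add_left _ _
  have im := Fin.castLE_injective hm
  have ip := Fin.castLE_injective hp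
  have e : sandwich (incl (Fin.castLE hp)) (sandwich α x β) (incl (Fin.castLE hp))ᵀ
      = sandwich (incl (Fin.castLE hp) * (α * (incl (Fin.castLE hm))ᵀ))
        (sandwich (incl (Fin.castLE hm)) x (incl (Fin.castLE hm))ᵀ)
        (incl (Fin.castLE hm) * (β * (incl (Fin.castLE hp))ᵀ)) := by
    rw [sandwich_sandwich, sandwich_sandwich]
    congr 1
    · rw [Matrix.mul_assoc, Matrix.mul_assoc, incl_transpose_mul im, Matrix.mul_one]
    · rw [← Matrix.mul_assoc, ← Matrix.mul_assoc, incl_transpose_mul im, Matrix.one_mul]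
  rw [← E.norm_incl hp, e]
  refine (E.norm_sandwich_le _ _ _ _).trans ?_
  rw [E.norm_incl hm]
  exact mul_norm_mul_le (norm_nonneg _) (apply_nonneg _ _) (norm_nonneg _)
    ((norm_incl_mul_le ip _).trans (norm_mul_inclT_le im _))
    ((norm_incl_mul_le im _).trans (norm_mul_inclT_le ip _))

theorem rectNorm_sandwich_le {m n p q : ℕ} (α : Matrix (Fin p) (Fin m) ℂ)
    (x : Matrix (Fin m) (Fin n) X) (β : Matrix (Fin n) (Fin q) ℂ) :
    E.rectNorm (sandwich α x β) ≤ ‖α‖ * E.rectNorm x * ‖β‖ := by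
  have im := Fin.castLE_injective (le_max_left m n)
  have jn := Fin.castLE_injective (le_max_right m n)
  have ip := Fin.castLE_injective (le_max_left p q)
  have jq := Fin.castLE_injective (le_max_right p q)
  have e : pad (sandwich α x β)
      = sandwich (incl (Fin.castLE (le_max_left p q)) * (α * (incl (Fin.castLE (le_max_left m n)))ᵀ))
        (pad x)
        (incl (Fin.castLE (le_max_right m n)) * (β * (incl (Fin.castLE (le_max_right p q)))ᵀ)) := by
    rw [pad_eq, pad_eq, sandwich_sandwich, sandwich_sandwich]
    congr 1
    · rw [Matrix.mul_assoc, Matrix.mul_assoc, incl_transpose_mul im, Matrix.mul_one]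
    · rw [← Matrix.mul_assoc, ← Matrix.mul_assoc, incl_transpose_mul jn, Matrix.one_mul]
  rw [rectNorm, e]
  refine (E.norm_sandwich_le' _ _ _).trans ?_
  exact mul_norm_mul_le (norm_nonneg _) (apply_nonneg _ _) (norm_nonneg _)
    ((norm_incl_mul_le ip _).trans (norm_mul_inclT_le im _))
    ((norm_incl_mul_le jn _).trans (norm_mul_inclT_le jq _))

theorem rectNorm_dsum_le {m n m' n' : ℕ} (x : Matrix (Fin m) (Fin n) X)
    (y : Matrix (Fin m') (Fin n') X) :
    E.rectNorm (dsum x y) ≤ max (E.rectNorm x) (E.rectNorm y) := by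
  have im := Fin.castLE_injective (le_max_left m n)
  have jn := Fin.castLE_injective (le_max_right m n)
  have im' := Fin.castLE_injective (le_max_left m' n')
  have jn' := Fin.castLE_injective (le_max_right m' n')
  have e : dsum x y = sandwich
      (dsum (incl (Fin.castLE (le_max_left m n)))ᵀ (incl (Fin.castLE (le_max_left m' n')))ᵀ)
      (dsum (pad x) (pad y))
      (dsum (incl (Fin.castLE (le_max_right m n))) (incl (Fin.castLE (le_max_right m' n')))) := by
    rw [sandwich_dsum, pad_eq, pad_eq, sandwich_sandwich, sandwich_sandwich,
      incl_transpose_mul im, incl_transpose_mul jn, incl_transpose_mul im',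
      incl_transpose_mul jn', sandwich_one, sandwich_one]
  have h1 := E.rectNorm_sandwich_le
    (dsum (incl (Fin.castLE (le_max_left m n)))ᵀ (incl (Fin.castLE (le_max_left m' n')))ᵀ)
      (dsum (pad x) (pad y))
      (dsum (incl (Fin.castLE (le_max_right m n))) (incl (Fin.castLE (le_max_right m' n'))))
  rw [← e, rectNorm_square, E.norm_dsum] at h1
  refine h1.trans ((mul_norm_mul_le (norm_nonneg _) ?_ (norm_nonneg _)
    ((norm_dsum_le _ _).trans (max_le (norm_incl_transpose_le im) (norm_incl_transpose_le im')))
    ((norm_dsum_le _ _).trans (max_le (norm_incl_le jn) (norm_incl_le jn')))).trans ?_)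
  · exact le_max_of_le_left (apply_nonneg _ _)
  · rw [one_mul, mul_one]
    exact le_rfl

/-- The opposite operator space structure: `‖[x j i]‖` in `X_o` is `‖[x i j]‖` in `X`. -/
def opp : OperatorSpaceStructure X where
  norm n := (E.norm n).comp (Matrix.transposeLinearEquiv (Fin n) (Fin n) ℂ X).toLinearMap
  eq_zero_of_norm_eq_zero n x h :=
    Matrix.transpose_eq_zero.1 (E.eq_zero_of_norm_eq_zero n xᵀ h)
  norm_dsum m n x y := by
    change E.norm _ (dsum x y)ᵀ = max (E.norm m xᵀ) (E.norm n yᵀ)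
    rw [dsum_transpose, E.norm_dsum]
  norm_sandwich_le m α x β := by
    change E.norm _ (sandwich α x β)ᵀ ≤ ‖α‖ * E.norm m xᵀ * ‖β‖
    rw [sandwich_transpose]
    refine (E.norm_sandwich_le _ _ _ _).trans (le_of_eq ?_)
    rw [norm_transpose, norm_transpose]
    ring

end Basic

/-- The operator space structure of `ℂ`, given by the operator norms of scalar matrices. -/
def complex : OperatorSpaceStructure ℂ where
  norm n := normSeminorm ℂ (Matrix (Fin n) (Fin n) ℂ)
  eq_zero_of_norm_eq_zero n x h := norm_eq_zero.1 h
  norm_dsum m n x y := by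
    change ‖dsum x y‖ = max ‖x‖ ‖y‖
    refine le_antisymm (norm_dsum_le x y) (max_le ?_ ?_)
    · refine opNorm_le_of (norm_nonneg _) fun v => ?_
      have h := sq_mulVec_le (dsum x y) (Fin.append v 0)
      have e1 : ∀ i : Fin m, (dsum x y *ᵥ Fin.append v 0) (Fin.castAdd n i) = (x *ᵥ v) i :=
        fun i => by simp [dsum, Matrix.mulVec, dotProduct, Fin.sum_univ_add]
      rw [Fin.sum_univ_add, Fin.sum_univ_add (fun i => ‖Fin.append v 0 i‖ ^ 2)] at h
      simp only [e1, Fin.append_left, Fin.append_right] at h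
      have h0 : 0 ≤ ∑ i : Fin n, ‖(dsum x y *ᵥ Fin.append v 0) (Fin.natAdd m i)‖ ^ 2 := by
        positivity
      simp at h h0 ⊢
      linarith
    · refine opNorm_le_of (norm_nonneg _) fun v => ?_
      have h := sq_mulVec_le (dsum x y) (Fin.append 0 v)
      have e1 : ∀ i : Fin n, (dsum x y *ᵥ Fin.append 0 v) (Fin.natAdd m i) = (y *ᵥ v) i :=
        fun i => by simp [dsum, Matrix.mulVec, dotProduct, Fin.sum_univ_add]
      rw [Fin.sum_univ_add, Fin.sum_univ_add (fun i => ‖Fin.append 0 v i‖ ^ 2)] at h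
      simp only [e1, Fin.append_left, Fin.append_right] at h
      have h0 : 0 ≤ ∑ i : Fin m, ‖(dsum x y *ᵥ Fin.append 0 v) (Fin.castAdd n i)‖ ^ 2 := by
        positivity
      simp at h h0 ⊢
      linarith
  norm_sandwich_le m α x β := by
    change ‖sandwich α x β‖ ≤ ‖α‖ * ‖x‖ * ‖β‖
    have e : sandwich α x β = α * x * β := by
      ext i j
      simp only [sandwich, Matrix.mul_apply, Finset.sum_mul, smul_eq_mul]
      rw [Finset.sum_comm]
      refine Finset.sum_congr rfl fun k _ => Finset.sum_congr rfl fun l _ => ?_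
      ring
    rw [e]
    exact (Matrix.l2_opNorm_mul _ _).trans
      (mul_le_mul_of_nonneg_right (Matrix.l2_opNorm_mul _ _) (norm_nonneg _))

end OperatorSpaceStructure

/-! The conjugate space. -/

/-- The conjugate `X_c` of a complex vector space: the same additive group, with scalar
multiplication `(c, x) ↦ conj c • x`. -/
def Conj (X : Type u) : Type u := X

namespace Conj

instance (X : Type u) [AddCommGroup X] : AddCommGroup (Conj X) := inferInstanceAs (AddCommGroup X)

instance (X : Type u) [AddCommGroup X] [Module ℂ X] : Module ℂ (Conj X) :=
  Module.compHom X (starRingEnd ℂ)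

variable {X : Type u} [AddCommGroup X] [Module ℂ X] {Y : Type v} [AddCommGroup Y] [Module ℂ Y]

/-- The identity map `X → X_c`, which is antilinear. -/
def mk : X →ₛₗ[starRingEnd ℂ] Conj X where
  toFun x := x
  map_add' _ _ := rfl
  map_smul' c x := by
    change c • x = (starRingEnd ℂ (starRingEnd ℂ c)) • x
    rw [Complex.conj_conj]

/-- The identity map `X_c → X`, which is antilinear. -/
def out : Conj X →ₛₗ[starRingEnd ℂ] X where
  toFun x := x
  map_add' _ _ := rfl
  map_smul' _ _ := rfl

/-- The linear map `f_c : X_c → Y_c` with the same underlying function as `f : X → Y`. -/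
def map (f : X →ₗ[ℂ] Y) : Conj X →ₗ[ℂ] Conj Y := (mk.comp f).comp out

/-- The identity map `X = X_cc`. -/
def toConjConj : X →ₗ[ℂ] Conj (Conj X) := mk.comp mk

/-- The identification `X_c ⊗ Y_c = (X ⊗ Y)_c`, `x ⊗ y ↦ x ⊗ y`. -/
def tensor : Conj X ⊗[ℂ] Conj Y →ₗ[ℂ] Conj (X ⊗[ℂ] Y) :=
  TensorProduct.lift
    (LinearMap.mk₂ ℂ (fun x y => mk (out x ⊗ₜ[ℂ] out y))
      (fun x x' y => by rw [map_add, TensorProduct.add_tmul, map_add])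
      (fun c x y => by
        rw [map_smulₛₗ, ← TensorProduct.smul_tmul', map_smulₛₗ, Complex.conj_conj])
      (fun x y y' => by rw [map_add, TensorProduct.tmul_add, map_add])
      (fun c x y => by
        rw [map_smulₛₗ, TensorProduct.tmul_smul, map_smulₛₗ, Complex.conj_conj]))

end Conj

namespace OperatorSpaceStructure

/-- The conjugate operator space structure: the norms of `M_n(X_c)` are those of `M_n(X)`. -/
def conj {X : Type u} [AddCommGroup X] [Module ℂ X] (E : OperatorSpaceStructure X) :
    OperatorSpaceStructure (Conj X) where
  norm n := Seminorm.of (fun x => E.norm n (x.map Conj.out))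
    (fun x y => by
      rw [Matrix.map_add _ (map_add _)]
      exact map_add_le_add _ _ _)
    (fun c x => by
      have e : (c • x).map Conj.out = (starRingEnd ℂ c) • x.map (Conj.out (X := X)) := by
        ext i j
        simp
      rw [e, map_smul_eq_mul, RCLike.norm_conj])
  eq_zero_of_norm_eq_zero n x h := E.eq_zero_of_norm_eq_zero n (x.map Conj.out) h
  norm_dsum m n x y := E.norm_dsum m n (x.map Conj.out) (y.map Conj.out)
  norm_sandwich_le m α x β := by
    have e : (sandwich α x β).map Conj.out
        = sandwich (α.map star) (x.map (Conj.out (X := X))) (β.map star) := by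
      ext i j
      simp [sandwich]
    change E.norm m ((sandwich α x β).map Conj.out) ≤ ‖α‖ * E.norm m (x.map Conj.out) * ‖β‖
    rw [e, ← norm_map_star α, ← norm_map_star β]
    exact E.norm_sandwich_le _ _ _ _

end OperatorSpaceStructure

namespace OperatorSpaceStructure

section Haagerup

variable {X : Type u} [AddCommGroup X] [Module ℂ X] (E : OperatorSpaceStructure X)
variable {Y : Type v} [AddCommGroup Y] [Module ℂ Y] (F : OperatorSpaceStructure Y)

/-- The Haagerup norm of `v ∈ M_n(X ⊗ Y)`: the infimum of `‖x‖ ‖y‖` over all factorizations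
`v = x ⊙ y` with `x ∈ M_{n,r}(X)` and `y ∈ M_{r,n}(Y)`. -/
def haagerupNorm (n : ℕ) (v : Matrix (Fin n) (Fin n) (X ⊗[ℂ] Y)) : ℝ :=
  sInf {t : ℝ | ∃ (r : ℕ) (x : Matrix (Fin n) (Fin r) X) (y : Matrix (Fin r) (Fin n) Y),
    v = matrixInner x y ∧ t = E.rectNorm x * F.rectNorm y}

theorem haagerupNorm_nonneg {n : ℕ} (v : Matrix (Fin n) (Fin n) (X ⊗[ℂ] Y)) :
    0 ≤ haagerupNorm E F n v := by
  refine Real.sInf_nonneg ?_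
  rintro t ⟨r, x, y, -, rfl⟩
  exact mul_nonneg (E.rectNorm_nonneg x) (F.rectNorm_nonneg y)

theorem haagerupNorm_le {n r : ℕ} (x : Matrix (Fin n) (Fin r) X) (y : Matrix (Fin r) (Fin n) Y) :
    haagerupNorm E F n (matrixInner x y) ≤ E.rectNorm x * F.rectNorm y := by
  refine csInf_le ⟨0, ?_⟩ ⟨r, x, y, rfl, rfl⟩
  rintro t ⟨r, x, y, -, rfl⟩
  exact mul_nonneg (E.rectNorm_nonneg x) (F.rectNorm_nonneg y)

/-- The scalar row `[s I, t I]`. -/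
def row (n : ℕ) (s t : ℝ) : Matrix (Fin n) (Fin (n + n)) ℂ :=
  (s : ℂ) • (incl (Fin.castAdd n))ᵀ + (t : ℂ) • (incl (Fin.natAdd n))ᵀ

theorem row_castAdd {n : ℕ} (s t : ℝ) (i k : Fin n) :
    row n s t i (Fin.castAdd n k) = if k = i then (s : ℂ) else 0 := by
  have h : ∀ l : Fin n, Fin.castAdd n k ≠ Fin.natAdd n l := fun l e => by
    have := congrArg Fin.val e
    simp at this
    omega
  simp [row, incl_apply, h, -Fin.natAdd_eq_addNat]

theorem row_natAdd {n : ℕ} (s t : ℝ) (i k : Fin n) :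
    row n s t i (Fin.natAdd n k) = if k = i then (t : ℂ) else 0 := by
  have h : ∀ l : Fin n, Fin.natAdd n k ≠ Fin.castAdd n l := fun l e => by
    have := congrArg Fin.val e
    simp at this
    omega
  simp [row, incl_apply, h, -Fin.natAdd_eq_addNat]

theorem norm_row_mul_self_le {n : ℕ} {s t : ℝ} :
    ‖row n s t‖ * ‖(row n s t)ᵀ‖ ≤ s * s + t * t := by
  have h1 := Matrix.l2_opNorm_conjTranspose_mul_self (row n s t)ᵀ
  have h2 : ((row n s t)ᵀᴴ * (row n s t)ᵀ)
      = ((s * s + t * t : ℝ) : ℂ) • (1 : Matrix (Fin n) (Fin n) ℂ) := by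
    ext i j
    rw [Matrix.mul_apply, Fin.sum_univ_add]
    simp only [Matrix.conjTranspose_apply, Matrix.transpose_apply, row_castAdd, row_natAdd]
    by_cases h : i = j
    · subst h
      simp
    · simp [apply_ite, Ne.symm h, h]
  rw [h2, norm_smul] at h1
  rw [norm_transpose] at h1 ⊢
  have h0 : 0 ≤ s * s + t * t := add_nonneg (mul_self_nonneg s) (mul_self_nonneg t)
  rw [← h1, Complex.norm_real, Real.norm_of_nonneg h0]
  exact (mul_le_mul_of_nonneg_left (norm_one_le n) h0).trans (mul_one _).le

theorem sandwich_row {Z : Type*} [AddCommGroup Z] [Module ℂ Z] {n : ℕ} (s t : ℝ)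
    (v w : Matrix (Fin n) (Fin n) Z) :
    sandwich (row n s t) (dsum v w) (row n s t)ᵀ
      = ((s * s : ℝ) : ℂ) • v + ((t * t : ℝ) : ℂ) • w := by
  ext i j
  simp only [sandwich, Fin.sum_univ_add, Matrix.transpose_apply, row_castAdd, row_natAdd]
  simp [dsum, -Fin.natAdd_eq_addNat]

theorem exists_matrixInner {n : ℕ} (v : Matrix (Fin n) (Fin n) (X ⊗[ℂ] Y)) :
    ∃ (r : ℕ) (x : Matrix (Fin n) (Fin r) X) (y : Matrix (Fin r) (Fin n) Y),
      v = matrixInner x y := by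
  have hadd : ∀ v w : Matrix (Fin n) (Fin n) (X ⊗[ℂ] Y),
      (∃ (r : ℕ) (x : Matrix (Fin n) (Fin r) X) (y : Matrix (Fin r) (Fin n) Y),
        v = matrixInner x y) →
      (∃ (r : ℕ) (x : Matrix (Fin n) (Fin r) X) (y : Matrix (Fin r) (Fin n) Y),
        w = matrixInner x y) →
      ∃ (r : ℕ) (x : Matrix (Fin n) (Fin r) X) (y : Matrix (Fin r) (Fin n) Y),
        v + w = matrixInner x y := by
    rintro v w ⟨r, x, y, rfl⟩ ⟨r', x', y', rfl⟩
    refine ⟨r + r', sandwich (row n 1 1) (dsum x x') (1 : Matrix (Fin (r + r')) (Fin (r + r')) ℂ),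
      sandwich (1 : Matrix (Fin (r + r')) (Fin (r + r')) ℂ) (dsum y y') (row n 1 1)ᵀ, ?_⟩
    rw [← sandwich_matrixInner, matrixInner_dsum, sandwich_row]
    simp
  have h0 : ∃ (r : ℕ) (x : Matrix (Fin n) (Fin r) X) (y : Matrix (Fin r) (Fin n) Y),
      (0 : Matrix (Fin n) (Fin n) (X ⊗[ℂ] Y)) = matrixInner x y := by
    refine ⟨0, 0, 0, ?_⟩
    ext i j
    simp [matrixInner]
  induction v using Matrix.induction_on' with
  | h_zero => exact h0
  | h_add v w hv hw => exact hadd v w hv hw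
  | h_std_basis i j z =>
    induction z using TensorProduct.induction_on with
    | zero => simpa using h0
    | tmul a b =>
      refine ⟨1, Matrix.of fun k _ => if k = i then a else 0,
        Matrix.of fun _ k => if k = j then b else 0, ?_⟩
      ext k l
      by_cases h1 : i = k <;> by_cases h2 : j = l <;>
        simp [matrixInner, Matrix.single, h1, h2, eq_comm (a := k), eq_comm (a := l)]
    | add a b ha hb =>
      rw [Matrix.single_add]
      exact hadd _ _ ha hb

theorem exists_lt_of_haagerupNorm_lt {n : ℕ} {v : Matrix (Fin n) (Fin n) (X ⊗[ℂ] Y)} {C : ℝ}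
    (h : haagerupNorm E F n v < C) :
    ∃ (r : ℕ) (x : Matrix (Fin n) (Fin r) X) (y : Matrix (Fin r) (Fin n) Y),
      v = matrixInner x y ∧ E.rectNorm x * F.rectNorm y < C := by
  obtain ⟨r₀, x₀, y₀, hv₀⟩ := exists_matrixInner v
  have hne : {t : ℝ | ∃ (r : ℕ) (x : Matrix (Fin n) (Fin r) X) (y : Matrix (Fin r) (Fin n) Y),
      v = matrixInner x y ∧ t = E.rectNorm x * F.rectNorm y}.Nonempty :=
    ⟨_, r₀, x₀, y₀, hv₀, rfl⟩
  obtain ⟨t, ⟨r, x, y, hv, rfl⟩, ht⟩ := exists_lt_of_csInf_lt hne h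
  exact ⟨r, x, y, hv, ht⟩

theorem rectNorm_smul {m n : ℕ} (c : ℂ) (x : Matrix (Fin m) (Fin n) X) :
    E.rectNorm (c • x) = ‖c‖ * E.rectNorm x := by
  have e : pad (c • x) = c • pad x := by
    ext i j
    by_cases h : i.1 < m ∧ j.1 < n <;> simp [pad, h]
  rw [rectNorm, e, map_smul_eq_mul]
  rfl

theorem matrixInner_smul_smul {n r m : ℕ} {c : ℂ} (hc : c ≠ 0) (x : Matrix (Fin n) (Fin r) X)
    (y : Matrix (Fin r) (Fin m) Y) : matrixInner (c • x) (c⁻¹ • y) = matrixInner x y := by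
  ext i j
  simp only [matrixInner, Matrix.smul_apply, TensorProduct.smul_tmul_smul, mul_inv_cancel₀ hc,
    one_smul]

/-- A factorization whose two factors are at most `1` in norm. -/
theorem exists_le_one_of_haagerupNorm_lt {n : ℕ} {v : Matrix (Fin n) (Fin n) (X ⊗[ℂ] Y)}
    (h : haagerupNorm E F n v < 1) :
    ∃ (r : ℕ) (x : Matrix (Fin n) (Fin r) X) (y : Matrix (Fin r) (Fin n) Y),
      v = matrixInner x y ∧ E.rectNorm x ≤ 1 ∧ F.rectNorm y ≤ 1 := by
  obtain ⟨r, x, y, rfl, hlt⟩ := exists_lt_of_haagerupNorm_lt E F h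
  have hx := E.rectNorm_nonneg x
  have hy := F.rectNorm_nonneg y
  obtain ⟨c, hc, h1, h2⟩ : ∃ c : ℝ, 0 < c ∧ c * E.rectNorm x ≤ 1 ∧ c⁻¹ * F.rectNorm y ≤ 1 := by
    rcases hx.eq_or_lt with h0 | h0
    · refine ⟨F.rectNorm y + 1, by positivity, by rw [← h0]; simp, ?_⟩
      rw [inv_mul_le_iff₀ (by positivity)]
      linarith
    · refine ⟨(E.rectNorm x)⁻¹, by positivity, (inv_mul_cancel₀ h0.ne').le, ?_⟩
      rw [inv_inv]
      exact hlt.le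
  have hc' : (c : ℂ) ≠ 0 := by exact_mod_cast hc.ne'
  refine ⟨r, (c : ℂ) • x, (c : ℂ)⁻¹ • y, (matrixInner_smul_smul hc' x y).symm, ?_, ?_⟩
  · rw [rectNorm_smul, Complex.norm_real, Real.norm_of_nonneg hc.le]
    exact h1
  · rw [rectNorm_smul, norm_inv, Complex.norm_real, Real.norm_of_nonneg hc.le]
    exact h2

theorem haagerupNorm_sandwich_le {m p : ℕ} (α : Matrix (Fin p) (Fin m) ℂ)
    (v : Matrix (Fin m) (Fin m) (X ⊗[ℂ] Y)) (β : Matrix (Fin m) (Fin p) ℂ) :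
    haagerupNorm E F p (sandwich α v β) ≤ ‖α‖ * haagerupNorm E F m v * ‖β‖ := by
  have key : ∀ C, haagerupNorm E F m v < C →
      haagerupNorm E F p (sandwich α v β) ≤ ‖α‖ * C * ‖β‖ := by
    intro C hC
    obtain ⟨r, x, y, rfl, hlt⟩ := exists_lt_of_haagerupNorm_lt E F hC
    rw [sandwich_matrixInner]
    refine (haagerupNorm_le E F _ _).trans ?_
    have h1 : E.rectNorm (sandwich α x 1) ≤ ‖α‖ * E.rectNorm x :=
      (E.rectNorm_sandwich_le α x 1).trans
        ((mul_le_mul_of_nonneg_left (norm_one_le r)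
          (mul_nonneg (norm_nonneg _) (E.rectNorm_nonneg x))).trans (mul_one _).le)
    have h2 : F.rectNorm (sandwich (1 : Matrix (Fin r) (Fin r) ℂ) y β) ≤ F.rectNorm y * ‖β‖ := by
      refine (F.rectNorm_sandwich_le 1 y β).trans ?_
      refine mul_le_mul_of_nonneg_right ?_ (norm_nonneg _)
      exact (mul_le_mul_of_nonneg_right (norm_one_le r) (F.rectNorm_nonneg y)).trans (one_mul _).le
    calc _ ≤ (‖α‖ * E.rectNorm x) * (F.rectNorm y * ‖β‖) :=
          mul_le_mul h1 h2 (F.rectNorm_nonneg _)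
            (mul_nonneg (norm_nonneg _) (E.rectNorm_nonneg x))
      _ = ‖α‖ * (E.rectNorm x * F.rectNorm y) * ‖β‖ := by ring
      _ ≤ _ := by gcongr
  have hlim : Filter.Tendsto (fun ε : ℝ => ‖α‖ * (haagerupNorm E F m v + ε) * ‖β‖)
      (nhdsWithin 0 (Set.Ioi 0)) (nhds (‖α‖ * (haagerupNorm E F m v + 0) * ‖β‖)) := by
    refine Filter.Tendsto.mono_left ?_ nhdsWithin_le_nhds
    exact Continuous.tendsto (by fun_prop) 0
  rw [add_zero] at hlim
  refine ge_of_tendsto hlim ?_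
  filter_upwards [self_mem_nhdsWithin] with ε hε
  exact key _ (by simpa using hε)

theorem haagerupNorm_dsum_lt_one {m n : ℕ} {v : Matrix (Fin m) (Fin m) (X ⊗[ℂ] Y)}
    {w : Matrix (Fin n) (Fin n) (X ⊗[ℂ] Y)} (hv : haagerupNorm E F m v < 1)
    (hw : haagerupNorm E F n w < 1) : haagerupNorm E F (m + n) (dsum v w) ≤ 1 := by
  obtain ⟨r, x, y, rfl, hx, hy⟩ := exists_le_one_of_haagerupNorm_lt E F hv
  obtain ⟨r', x', y', rfl, hx', hy'⟩ := exists_le_one_of_haagerupNorm_lt E F hw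
  rw [← matrixInner_dsum]
  refine (haagerupNorm_le E F _ _).trans ?_
  exact mul_le_one₀ ((E.rectNorm_dsum_le x x').trans (max_le hx hx'))
    (F.rectNorm_nonneg _) ((F.rectNorm_dsum_le y y').trans (max_le hy hy'))

theorem sandwich_smul_one {Z : Type*} [AddCommGroup Z] [Module ℂ Z] {n : ℕ} (c : ℂ)
    (v : Matrix (Fin n) (Fin n) Z) : sandwich (c • (1 : Matrix (Fin n) (Fin n) ℂ)) v 1 = c • v := by
  ext i j
  simp [sandwich, Matrix.one_apply, Matrix.smul_apply]

theorem haagerupNorm_smul_le {n : ℕ} (c : ℂ) (v : Matrix (Fin n) (Fin n) (X ⊗[ℂ] Y)) :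
    haagerupNorm E F n (c • v) ≤ ‖c‖ * haagerupNorm E F n v := by
  have h := haagerupNorm_sandwich_le E F (c • (1 : Matrix (Fin n) (Fin n) ℂ)) v 1
  rw [sandwich_smul_one, norm_smul] at h
  refine h.trans ?_
  have h1 := norm_one_le n
  have h0 := haagerupNorm_nonneg E F v
  calc _ ≤ ‖c‖ * 1 * haagerupNorm E F n v * 1 := by gcongr
    _ = _ := by ring

theorem haagerupNorm_zero (n : ℕ) :
    haagerupNorm E F n (0 : Matrix (Fin n) (Fin n) (X ⊗[ℂ] Y)) = 0 := by
  refine le_antisymm ?_ (haagerupNorm_nonneg E F _)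
  simpa using haagerupNorm_smul_le E F 0 (0 : Matrix (Fin n) (Fin n) (X ⊗[ℂ] Y))

theorem haagerupNorm_add_le {n : ℕ} (v w : Matrix (Fin n) (Fin n) (X ⊗[ℂ] Y)) :
    haagerupNorm E F n (v + w) ≤ haagerupNorm E F n v + haagerupNorm E F n w := by
  refine le_of_forall_pos_le_add fun ε hε => ?_
  have hv := haagerupNorm_nonneg E F v
  have hw := haagerupNorm_nonneg E F w
  have scale : ∀ (u : Matrix (Fin n) (Fin n) (X ⊗[ℂ] Y)) (c : ℝ), 0 < c →
      haagerupNorm E F n u < c → haagerupNorm E F n (((c⁻¹ : ℝ) : ℂ) • u) < 1 := by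
    intro u c hc hu
    refine (haagerupNorm_smul_le E F _ _).trans_lt ?_
    rw [Complex.norm_real, Real.norm_of_nonneg (by positivity), inv_mul_lt_iff₀ hc]
    simpa using hu
  set a := haagerupNorm E F n v + ε / 2 with ha
  set b := haagerupNorm E F n w + ε / 2 with hb
  have ha0 : 0 < a := by positivity
  have hb0 : 0 < b := by positivity
  have h1 := haagerupNorm_dsum_lt_one E F (scale v a ha0 (by linarith))
    (scale w b hb0 (by linarith))
  have h2 := haagerupNorm_sandwich_le E F (row n (√a) (√b))
    (dsum (((a⁻¹ : ℝ) : ℂ) • v) (((b⁻¹ : ℝ) : ℂ) • w)) (row n (√a) (√b))ᵀ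
  rw [sandwich_row, Real.mul_self_sqrt ha0.le, Real.mul_self_sqrt hb0.le, smul_smul, smul_smul,
    ← Complex.ofReal_mul, ← Complex.ofReal_mul, mul_inv_cancel₀ ha0.ne', mul_inv_cancel₀ hb0.ne',
    Complex.ofReal_one, one_smul, one_smul] at h2
  have h3 := norm_row_mul_self_le (n := n) (s := √a) (t := √b)
  rw [Real.mul_self_sqrt ha0.le, Real.mul_self_sqrt hb0.le] at h3
  have h4 := norm_nonneg (row n (√a) (√b))
  have h5 := norm_nonneg (row n (√a) (√b))ᵀ
  calc _ ≤ _ := h2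
    _ ≤ ‖row n (√a) (√b)‖ * 1 * ‖(row n (√a) (√b))ᵀ‖ := by gcongr
    _ ≤ a + b := by rw [mul_one]; exact h3
    _ = _ := by rw [ha, hb]; ring

theorem haagerupNorm_dsum {m n : ℕ} (v : Matrix (Fin m) (Fin m) (X ⊗[ℂ] Y))
    (w : Matrix (Fin n) (Fin n) (X ⊗[ℂ] Y)) :
    haagerupNorm E F (m + n) (dsum v w) = max (haagerupNorm E F m v) (haagerupNorm E F n w) := by
  have hv := haagerupNorm_nonneg E F v
  have hw := haagerupNorm_nonneg E F w
  have hvw := haagerupNorm_nonneg E F (dsum v w)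
  refine le_antisymm ?_ (max_le ?_ ?_)
  · refine le_of_forall_pos_le_add fun ε hε => ?_
    set c := max (haagerupNorm E F m v) (haagerupNorm E F n w) + ε with hc
    have hc0 : 0 < c := by positivity
    have h1 : ∀ {k : ℕ} (u : Matrix (Fin k) (Fin k) (X ⊗[ℂ] Y)), haagerupNorm E F k u < c →
        haagerupNorm E F k (((c⁻¹ : ℝ) : ℂ) • u) < 1 := by
      intro k u hu
      refine (haagerupNorm_smul_le E F _ _).trans_lt ?_
      rw [Complex.norm_real, Real.norm_of_nonneg (by positivity), inv_mul_lt_iff₀ hc0]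
      simpa using hu
    have h2 := haagerupNorm_dsum_lt_one E F
      (h1 v ((le_max_left _ _).trans_lt (lt_add_of_pos_right _ hε)))
      (h1 w ((le_max_right _ _).trans_lt (lt_add_of_pos_right _ hε)))
    have e : dsum v w = (c : ℂ) • dsum (((c⁻¹ : ℝ) : ℂ) • v) (((c⁻¹ : ℝ) : ℂ) • w) := by
      have hc' : (c : ℂ) ≠ 0 := by exact_mod_cast hc0.ne'
      ext i j
      induction i using Fin.addCases <;> induction j using Fin.addCases <;> simp [dsum, hc']
    rw [e]
    refine (haagerupNorm_smul_le E F _ _).trans ?_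
    rw [Complex.norm_real, Real.norm_of_nonneg hc0.le]
    exact (mul_le_mul_of_nonneg_left h2 hc0.le).trans (mul_one _).le
  · have inj : (Fin.castAdd n : Fin m → Fin (m + n)).Injective := Fin.castAdd_injective m n
    have h := haagerupNorm_sandwich_le E F (incl (Fin.castAdd n))ᵀ (dsum v w) (incl (Fin.castAdd n))
    have e : sandwich (incl (Fin.castAdd n))ᵀ (dsum v w) (incl (Fin.castAdd n)) = v := by
      ext i j
      simp [sandwich, incl_apply, dsum]
    rw [e] at h
    refine h.trans ((mul_norm_mul_le (norm_nonneg _) hvw (norm_nonneg _)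
      (norm_incl_transpose_le inj) (norm_incl_le inj)).trans ?_)
    simp
  · have inj : (Fin.natAdd m : Fin n → Fin (m + n)).Injective := Fin.natAdd_injective n m
    have h := haagerupNorm_sandwich_le E F (incl (Fin.natAdd m))ᵀ (dsum v w) (incl (Fin.natAdd m))
    have e : sandwich (incl (Fin.natAdd m))ᵀ (dsum v w) (incl (Fin.natAdd m)) = w := by
      ext i j
      simp [sandwich, incl_apply, dsum]
    rw [e] at h
    refine h.trans ((mul_norm_mul_le (norm_nonneg _) hvw (norm_nonneg _)
      (norm_incl_transpose_le inj) (norm_incl_le inj)).trans ?_)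
    simp

/-- Linear functionals on a finite-dimensional space are bounded for the ground norm. -/
theorem exists_bound [FiniteDimensional ℂ X] (f : X →ₗ[ℂ] ℂ) :
    ∃ C, 0 ≤ C ∧ ∀ x, ‖f x‖ ≤ C * E.groundNorm x := by
  let _ : NormedAddCommGroup X := AddGroupNorm.toNormedAddCommGroup
    { E.groundNorm.toAddGroupSeminorm with
      eq_zero_of_map_eq_zero' := fun x hx => by
        have := E.eq_zero_of_norm_eq_zero 1 _ hx
        exact congrFun (congrFun this 0) 0 }
  let _ : NormedSpace ℂ X := ⟨fun c x => (map_smul_eq_mul E.groundNorm c x).le⟩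
  exact ⟨‖LinearMap.toContinuousLinearMap f‖, norm_nonneg _,
    fun x => (LinearMap.toContinuousLinearMap f).le_opNorm x⟩

theorem sum_sq_le {n r : ℕ} {f : X →ₗ[ℂ] ℂ} {C : ℝ} (hC : 0 ≤ C)
    (hf : ∀ x, ‖f x‖ ≤ C * E.groundNorm x) (x : Matrix (Fin n) (Fin r) X) (i : Fin n) :
    √(∑ k, ‖f (x i k)‖ ^ 2) ≤ C * E.rectNorm x := by
  set S := ∑ k, ‖f (x i k)‖ ^ 2 with hS
  have hS0 : 0 ≤ S := Finset.sum_nonneg fun _ _ => sq_nonneg _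
  have hx := E.rectNorm_nonneg x
  let e : Matrix (Fin 1) (Fin n) ℂ := (incl fun _ : Fin 1 => i)ᵀ
  let c : Matrix (Fin r) (Fin 1) ℂ := Matrix.of fun k _ => star (f (x i k))
  have he : ‖e‖ ≤ 1 := norm_incl_transpose_le fun _ _ _ => Subsingleton.elim _ _
  have hc : ‖c‖ ≤ √S := by
    refine opNorm_le_of (Real.sqrt_nonneg _) fun v => ?_
    rw [Real.sq_sqrt hS0, hS, Finset.sum_mul]
    refine Finset.sum_le_sum fun k _ => ?_
    simp [c, Matrix.mulVec, dotProduct, mul_pow]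
  have h1 := E.rectNorm_sandwich_le e x c
  rw [rectNorm_square] at h1
  have h2 : E.norm 1 (sandwich e x c) = E.groundNorm (∑ k, star (f (x i k)) • x i k) := by
    change _ = E.norm 1 (fun _ _ => ∑ k, star (f (x i k)) • x i k)
    congr 1
    ext a b
    simp only [sandwich, e, c, Matrix.transpose_apply, incl_apply, Matrix.of_apply]
    rw [Finset.sum_comm]
    simp
  have h3 : f (∑ k, star (f (x i k)) • x i k) = (S : ℂ) := by
    rw [map_sum, hS, Complex.ofReal_sum]
    refine Finset.sum_congr rfl fun k _ => ?_
    rw [map_smul, smul_eq_mul, Complex.ofReal_pow]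
    exact Complex.conj_mul' _
  have h4 := hf (∑ k, star (f (x i k)) • x i k)
  rw [h3, Complex.norm_real, Real.norm_of_nonneg hS0, ← h2] at h4
  have h5 : S ≤ C * E.rectNorm x * √S := by
    calc S ≤ _ := h4
      _ ≤ C * (‖e‖ * E.rectNorm x * ‖c‖) := by gcongr
      _ ≤ C * (1 * E.rectNorm x * √S) := by gcongr
      _ = _ := by ring
  rcases (Real.sqrt_nonneg S).eq_or_lt with h0 | h0
  · rw [← h0]
    positivity
  · refine le_of_mul_le_mul_right ?_ h0
    rwa [Real.mul_self_sqrt hS0]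

theorem sum_sq_le' {n r : ℕ} {f : X →ₗ[ℂ] ℂ} {C : ℝ} (hC : 0 ≤ C)
    (hf : ∀ x, ‖f x‖ ≤ C * E.groundNorm x) (x : Matrix (Fin r) (Fin n) X) (j : Fin n) :
    √(∑ k, ‖f (x k j)‖ ^ 2) ≤ C * E.rectNorm x := by
  have h := E.opp.sum_sq_le hC hf xᵀ j
  have e : E.opp.rectNorm xᵀ = E.rectNorm x := by
    have h1 : ∀ N, N = max r n → E.rectNorm x = E.norm N
        (fun i j => if h : i.1 < r ∧ j.1 < n then x ⟨i.1, h.1⟩ ⟨j.1, h.2⟩ else 0) := by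
      rintro N rfl
      rfl
    rw [h1 _ (max_comm n r)]
    change E.norm _ (pad xᵀ)ᵀ = _
    congr 1
    ext i j
    by_cases h : i.1 < r ∧ j.1 < n
    · rw [dif_pos h]
      exact dif_pos h.symm
    · rw [dif_neg h]
      exact dif_neg fun h' => h h'.symm
  rwa [e] at h

theorem norm_map_le_haagerupNorm {n : ℕ} {f : X →ₗ[ℂ] ℂ} {g : Y →ₗ[ℂ] ℂ} {C D : ℝ} (hC : 0 ≤ C)
    (hD : 0 ≤ D) (hf : ∀ x, ‖f x‖ ≤ C * E.groundNorm x) (hg : ∀ y, ‖g y‖ ≤ D * F.groundNorm y)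
    (v : Matrix (Fin n) (Fin n) (X ⊗[ℂ] Y)) (i j : Fin n) :
    ‖TensorProduct.lid ℂ ℂ (TensorProduct.map f g (v i j))‖ ≤ C * D * haagerupNorm E F n v := by
  refine le_of_forall_pos_le_add fun ε hε => ?_
  have h1 : haagerupNorm E F n v < haagerupNorm E F n v + ε / (C * D + 1) :=
    lt_add_of_pos_right _ (by positivity)
  obtain ⟨r, x, y, hv, hlt⟩ := exists_lt_of_haagerupNorm_lt E F h1
  have e : TensorProduct.lid ℂ ℂ (TensorProduct.map f g (v i j))
      = ∑ k, f (x i k) * g (y k j) := by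
    rw [hv]
    simp [matrixInner, map_sum]
  rw [e]
  have hx := E.rectNorm_nonneg x
  calc _ ≤ ∑ k, ‖f (x i k)‖ * ‖g (y k j)‖ := by
        refine (norm_sum_le _ _).trans (le_of_eq ?_)
        simp
    _ ≤ √(∑ k, ‖f (x i k)‖ ^ 2) * √(∑ k, ‖g (y k j)‖ ^ 2) :=
        Real.sum_mul_le_sqrt_mul_sqrt _ _ _
    _ ≤ (C * E.rectNorm x) * (D * F.rectNorm y) :=
        mul_le_mul (E.sum_sq_le hC hf x i) (F.sum_sq_le' hD hg y j) (Real.sqrt_nonneg _)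
          (by positivity)
    _ = C * D * (E.rectNorm x * F.rectNorm y) := by ring
    _ ≤ C * D * (haagerupNorm E F n v + ε / (C * D + 1)) := by gcongr
    _ = C * D * haagerupNorm E F n v + ε * (C * D / (C * D + 1)) := by ring
    _ ≤ C * D * haagerupNorm E F n v + ε * 1 := by
        gcongr
        rw [div_le_one (by positivity)]
        linarith
    _ = _ := by ring

theorem eq_zero_of_haagerupNorm_eq_zero [FiniteDimensional ℂ X] [FiniteDimensional ℂ Y] {n : ℕ}
    (v : Matrix (Fin n) (Fin n) (X ⊗[ℂ] Y)) (h : haagerupNorm E F n v = 0) : v = 0 := by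
  ext i j
  let b := Module.finBasis ℂ X
  let c := Module.finBasis ℂ Y
  have key : ∀ p q z, (b.tensorProduct c).repr z (p, q)
      = TensorProduct.lid ℂ ℂ (TensorProduct.map (b.coord p) (c.coord q) z) := by
    intro p q z
    induction z using TensorProduct.induction_on with
    | zero => simp
    | tmul x y => simp [mul_comm]
    | add x y hx hy => simp [hx, hy]
  refine (b.tensorProduct c).ext_elem fun ⟨p, q⟩ => ?_
  obtain ⟨C, hC, hf⟩ := E.exists_bound (b.coord p)
  obtain ⟨D, hD, hg⟩ := F.exists_bound (c.coord q)
  have h1 := norm_map_le_haagerupNorm E F hC hD hf hg v i j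
  rw [h, mul_zero] at h1
  rw [key, norm_le_zero_iff.1 h1]
  simp

/-- The Haagerup tensor product `X ⊗_h Y` of finite-dimensional operator spaces. -/
def haagerup [FiniteDimensional ℂ X] [FiniteDimensional ℂ Y] :
    OperatorSpaceStructure (X ⊗[ℂ] Y) where
  norm n := Seminorm.ofSMulLE (haagerupNorm E F n) (haagerupNorm_zero E F n)
    (haagerupNorm_add_le E F) (haagerupNorm_smul_le E F)
  eq_zero_of_norm_eq_zero _ v h := eq_zero_of_haagerupNorm_eq_zero E F v h
  norm_dsum _ _ v w := haagerupNorm_dsum E F v w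
  norm_sandwich_le _ α v β := haagerupNorm_sandwich_le E F α v β

end Haagerup

end OperatorSpaceStructure

/-! Morphisms of operator spaces. -/

section Morphisms

variable {X : Type u} [AddCommGroup X] [Module ℂ X] {Y : Type v} [AddCommGroup Y] [Module ℂ Y]

/-- A linear map is a complete contraction if all its amplifications are contractions. These are
the morphisms of the category of finite-dimensional operator spaces. -/
def IsCompleteContraction (E : OperatorSpaceStructure X) (F : OperatorSpaceStructure Y)
    (f : X →ₗ[ℂ] Y) : Prop :=
  ∀ (n : ℕ) (x : Matrix (Fin n) (Fin n) X), F.norm n (x.map f) ≤ E.norm n x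

/-- A linear map is a complete isometry if all its amplifications are isometries. -/
def IsCompleteIsometry (E : OperatorSpaceStructure X) (F : OperatorSpaceStructure Y)
    (f : X →ₗ[ℂ] Y) : Prop :=
  ∀ (n : ℕ) (x : Matrix (Fin n) (Fin n) X), F.norm n (x.map f) = E.norm n x

end Morphisms

/-! The two definitions of a finite-dimensional von Neumann algebra. -/

/-- The structure of a finite-dimensional von Neumann algebra (equivalently, C*-algebra) on a
finite-dimensional complex vector space, in the standard sense. -/
@[ext]
structure VNAlgebra (A : Type u) [AddCommGroup A] [Module ℂ A] where
  mul : A →ₗ[ℂ] A →ₗ[ℂ] A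
  one : A
  star : A →ₛₗ[starRingEnd ℂ] A
  norm : Seminorm ℂ A
  eq_zero_of_norm_eq_zero : ∀ a, norm a = 0 → a = 0
  mul_assoc : ∀ a b c, mul a (mul b c) = mul (mul a b) c
  one_mul : ∀ a, mul one a = a
  mul_one : ∀ a, mul a one = a
  star_star : ∀ a, star (star a) = a
  star_mul : ∀ a b, star (mul a b) = mul (star b) (star a)
  norm_mul_le : ∀ a b, norm (mul a b) ≤ norm a * norm b
  norm_star_mul_self : ∀ a, norm (mul (star a) a) = norm a ^ 2

/-- `E` is the canonical operator space structure of the algebra `S`: for every `n`, its norm on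
`M_n(A)` makes `M_n(A)`, with the matrix multiplication, unit and involution induced from `S`,
a von Neumann algebra. -/
def VNAlgebra.IsCanonical {A : Type u} [AddCommGroup A] [Module ℂ A] (S : VNAlgebra A)
    (E : OperatorSpaceStructure A) : Prop :=
  ∀ n : ℕ, ∃ T : VNAlgebra (Matrix (Fin n) (Fin n) A),
    (∀ x y i j, T.mul x y i j = ∑ k, S.mul (x i k) (y k j)) ∧
    T.one = Matrix.diagonal (fun _ => S.one) ∧
    (∀ x i j, T.star x i j = S.star (x j i)) ∧
    T.norm = E.norm n

section Diagrams

variable {A : Type u} [AddCommGroup A] [Module ℂ A]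

/-- The swap `γ : Y ⊗ X → X ⊗ Y`, `y ⊗ x ↦ x ⊗ y`. -/
def swap {X : Type u} [AddCommGroup X] [Module ℂ X] {Y : Type v} [AddCommGroup Y] [Module ℂ Y] :
    Y ⊗[ℂ] X →ₗ[ℂ] X ⊗[ℂ] Y :=
  (TensorProduct.comm ℂ Y X).toLinearMap

/-- The composite
`ℂ ≅ ℂ_o ⊗ ℂ_c → A_o ⊗ A_c → A_o ⊗ A_o → (A ⊗ A)_o → A_o`
of `c ↦ c ⊗ 1`, `a ⊗ a`, `id ⊗ i`, `γ` and `μ`; the underlying vector space of `X_o` is that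
of `X`. -/
def starMulSelf (μ : A ⊗[ℂ] A →ₗ[ℂ] A) (i : Conj A →ₗ[ℂ] A) (a : ℂ →ₗ[ℂ] A) : ℂ →ₗ[ℂ] A :=
  μ ∘ₗ swap ∘ₗ TensorProduct.map LinearMap.id i ∘ₗ TensorProduct.map a (Conj.map a) ∘ₗ
    (TensorProduct.mk ℂ ℂ (Conj ℂ)).flip (Conj.mk (1 : ℂ))

end Diagrams

/-- The structure of a finite-dimensional von Neumann algebra on a finite-dimensional complex
vector space, in the categorical sense: an operator space structure with which `A` is a monoid
object for the Haagerup tensor product, with a reversing involution `i : A_c → A_o`. -/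
@[ext]
structure HaagerupVNAlgebra (A : Type u) [AddCommGroup A] [Module ℂ A]
    [FiniteDimensional ℂ A] where
  oss : OperatorSpaceStructure A
  mul : A ⊗[ℂ] A →ₗ[ℂ] A
  unit : ℂ →ₗ[ℂ] A
  inv : Conj A →ₗ[ℂ] A
  mul_contraction : IsCompleteContraction (oss.haagerup oss) oss mul
  unit_contraction : IsCompleteContraction OperatorSpaceStructure.complex oss unit
  inv_contraction : IsCompleteContraction oss.conj oss.opp inv
  mul_assoc : mul ∘ₗ TensorProduct.map mul LinearMap.id =
    mul ∘ₗ TensorProduct.map LinearMap.id mul ∘ₗ (TensorProduct.assoc ℂ A A A).toLinearMap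
  one_mul : mul ∘ₗ TensorProduct.map unit LinearMap.id = (TensorProduct.lid ℂ A).toLinearMap
  mul_one : mul ∘ₗ TensorProduct.map LinearMap.id unit = (TensorProduct.rid ℂ A).toLinearMap
  involution : inv ∘ₗ Conj.map inv ∘ₗ Conj.toConjConj = LinearMap.id
  reverse_multiplicative : inv ∘ₗ Conj.map mul ∘ₗ Conj.tensor =
    mul ∘ₗ swap ∘ₗ TensorProduct.map inv inv
  cstar_identity : ∀ a : ℂ →ₗ[ℂ] A,
    IsCompleteIsometry OperatorSpaceStructure.complex oss a →
      IsCompleteIsometry OperatorSpaceStructure.complex oss.opp (starMulSelf mul inv a)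

/-- The data of `S` and of `C` are those determined by one another: same multiplication, unit and
involution, the norm of `S` is the ground norm of `C`, and the operator space structure of `C` is
the canonical one of `S`. -/
structure VNAlgebra.Corresponds {A : Type u} [AddCommGroup A] [Module ℂ A]
    [FiniteDimensional ℂ A] (S : VNAlgebra A) (C : HaagerupVNAlgebra A) : Prop where
  mul_eq : ∀ a b, C.mul (a ⊗ₜ[ℂ] b) = S.mul a b
  unit_eq : C.unit 1 = S.one
  inv_eq : ∀ a, C.inv (Conj.mk a) = S.star a
  norm_eq : C.oss.groundNorm = S.norm
  canonical : S.IsCanonical C.oss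

end

end FdOS

/-! From (I) to (II), the C*-norms of the algebras `M_n(A)` form an operator space structure
(`canonical`): injective *-homomorphisms are isometric, which gives the axiom on direct sums, and
all *-homomorphisms are contractive, which gives the axiom on scalar matrices. Complete
contractivity of the product on the Haagerup tensor product follows from submultiplicativity of
these matrix norms. A complete isometry from `ℂ` is the same thing as an element of norm one
(`isCompleteIsometry_iff`), so condition 4 is the C*-identity on unit vectors. There is no choice,
since a *-algebra carries at most one C*-norm (`norm_eq_of_equiv`).

From (II) to (I), the axioms read at the ground level make `A` a C*-algebra. The substance is that
the given norm p on `M_n(A)` must be the C*-norm (`eq_canonical`). What is known of p: it is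
submultiplicative, the adjoint is contractive for it, Ruan's axioms hold, and it is the C*-norm for
n = 1.

Upper bound (`norm_le_matNorm`). By Ruan's axioms alone, every selfadjoint h in `M_n(A)` is
hermitian for p, that is p(1 + ith) ≤ 1 + O(t²): for h = vv* ⊗ a this is a compression of the case n
= 1 (`norm_one_add_rankOne_le`), and such elements span the selfadjoint ones over the reals.
Hermiticity and submultiplicativity give p(exp(ih)) ≤ 1, and a selfadjoint contraction is the
average of the unitaries exp(±i arccos h), so p(h) ≤ ‖h‖. An arbitrary x is a corner of the
selfadjoint matrix with off-diagonal blocks x and x*.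

Lower bound (`matNorm_le_norm`). The two norms are equivalent, and for selfadjoint y the identity
‖y^(2^k)‖ = ‖y‖^(2^k) removes the constant, so ‖y‖ ≤ p(y). Then ‖x‖² = ‖x*x‖ ≤ p(x*)p(x) ≤ p(x)². -/

namespace FdOS

noncomputable section

open scoped TensorProduct Matrix
open scoped Matrix.Norms.L2Operator

universe u

/-! Norms on C*-algebras for which the selfadjoint elements are hermitian. -/

section Hermitian

variable {B : Type u} [CStarAlgebra B]

/-- `h` is hermitian for `p`: `p (1 + i t h) ≤ 1 + O(t ^ 2)` for real `t`. -/
def IsHermitianFor (p : Seminorm ℂ B) (h : B) : Prop :=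
  ∃ C : ℝ, 0 ≤ C ∧ ∀ t : ℝ, p (1 + (t * Complex.I) • h) ≤ 1 + C * t ^ 2

theorem IsHermitianFor.add {p : Seminorm ℂ B} {h k : B} (hh : IsHermitianFor p h)
    (hk : IsHermitianFor p k) : IsHermitianFor p (h + k) := by
  obtain ⟨C, hC, h1⟩ := hh
  obtain ⟨D, hD, h2⟩ := hk
  refine ⟨2 * (C + D), by positivity, fun t => ?_⟩
  -- An average of two elements taken at parameter 2t; the factor 2² / 2 explains the constant 2(C +
  -- D).
  have e : (1 : B) + (t * Complex.I) • (h + k) = (1 / 2 : ℂ) • (1 + ((2 * t : ℝ) * Complex.I) • h)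
      + (1 / 2 : ℂ) • (1 + ((2 * t : ℝ) * Complex.I) • k) := by
    push_cast
    module
  rw [e]
  refine (map_add_le_add p _ _).trans ?_
  rw [map_smul_eq_mul, map_smul_eq_mul]
  have h1 := h1 (2 * t)
  have h2 := h2 (2 * t)
  push_cast at h1 h2 ⊢
  norm_num
  linarith

theorem IsHermitianFor.smul {p : Seminorm ℂ B} {h : B} (hh : IsHermitianFor p h) (r : ℝ) :
    IsHermitianFor p ((r : ℂ) • h) := by
  obtain ⟨C, hC, h1⟩ := hh
  refine ⟨C * r ^ 2, by positivity, fun t => ?_⟩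
  have := h1 (t * r)
  rw [smul_smul]
  push_cast at this
  rw [mul_right_comm] at this
  refine this.trans (le_of_eq ?_)
  ring

/-- The exponent 0 is excluded because p(1) ≤ 1 is not assumed. -/
theorem seminorm_pow_le {p : Seminorm ℂ B} (hmul : ∀ x y, p (x * y) ≤ p x * p y) (x : B) {m : ℕ}
    (hm : m ≠ 0) : p (x ^ m) ≤ p x ^ m := by
  induction m with
  | zero => exact absurd rfl hm
  | succ m ih =>
    rcases Nat.eq_zero_or_pos m with rfl | h
    · simp
    · rw [pow_succ, pow_succ]
      exact (hmul _ _).trans (mul_le_mul_of_nonneg_right (ih h.ne') (apply_nonneg _ _))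

/-- The unitary `exp (i θ(a))`. -/
def cfcExp (θ : ℝ → ℝ) (a : B) : B := cfc (fun z : ℂ => Complex.exp (θ z.re * Complex.I)) a

/-- The m-th root exp(iθ(a)/m) differs from 1 + (i/m)θ(a) by a remainder of C*-norm O(1/m²), and
θ(a) is selfadjoint, hence hermitian for p. So p of the root is at most 1 + K/m², and the m-th power
is at most exp(K/m), which tends to 1. The crude bound p ≤ M‖·‖ serves only to control the
remainder. -/
theorem seminorm_cfcExp_le {p : Seminorm ℂ B} (hmul : ∀ x y, p (x * y) ≤ p x * p y) {M : ℝ}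
    (hM : 0 ≤ M) (hpM : ∀ x, p x ≤ M * ‖x‖) (hp : ∀ h : B, IsSelfAdjoint h → IsHermitianFor p h)
    {θ : ℝ → ℝ} (hθ : Continuous θ) {R : ℝ} (hR : ∀ s, |θ s| ≤ R) {a : B}
    (ha : IsSelfAdjoint a) : p (cfcExp θ a) ≤ 1 := by
  have ha' : IsStarNormal a := ha.isStarNormal
  have hR0 : 0 ≤ R := (abs_nonneg _).trans (hR 0)
  obtain ⟨C, hC, hCt⟩ := hp (cfc (fun z : ℂ => ((θ z.re : ℝ) : ℂ)) a) (by
    rw [IsSelfAdjoint, ← cfc_star]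
    simp)
  set K := C + M * R ^ 2 with hK
  have hK0 : 0 ≤ K := by positivity
  -- R ≤ m puts w = iθ/m in the unit disc, where |exp w - 1 - w| ≤ |w|².
  have key : ∀ m : ℕ, m ≠ 0 → R ≤ m → p (cfcExp θ a) ≤ (1 + K * (1 / m) ^ 2) ^ m := by
    intro m hm hRm
    have hm0 : (0 : ℝ) < m := by positivity
    have e1 : cfcExp θ a = (cfcExp (fun s => θ s / m) a) ^ m := by
      rw [cfcExp, cfcExp, ← cfc_pow _ m a (by fun_prop)]
      congr 1
      ext z
      rw [← Complex.exp_nat_mul]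
      congr 1
      push_cast
      field_simp
    have e2 : cfcExp (fun s => θ s / m) a
        = (1 + (((1 / m : ℝ) : ℂ) * Complex.I) • cfc (fun z : ℂ => ((θ z.re : ℝ) : ℂ)) a)
        + cfc (fun z : ℂ => Complex.exp ((θ z.re / m : ℝ) * Complex.I) - 1
          - (θ z.re / m : ℝ) * Complex.I) a := by
      rw [← cfc_const_one ℂ a, ← cfc_smul _ _ a (by fun_prop), ← cfc_add .., ← cfc_add .., cfcExp]
      congr 1
      ext z
      simp only [smul_eq_mul]
      push_cast
      ring
    have h3 : ‖cfc (fun z : ℂ => Complex.exp ((θ z.re / m : ℝ) * Complex.I) - 1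
          - (θ z.re / m : ℝ) * Complex.I) a‖ ≤ (R / m) ^ 2 := by
      refine norm_cfc_le (by positivity) fun z _ => ?_
      have h4 : ‖((θ z.re / m : ℝ) : ℂ) * Complex.I‖ ≤ R / m := by
        rw [norm_mul, Complex.norm_I, mul_one, Complex.norm_real, Real.norm_eq_abs, abs_div,
          abs_of_pos hm0]
        gcongr
        exact hR _
      refine (Complex.norm_exp_sub_one_sub_id_le
        (h4.trans ((div_le_one hm0).2 hRm))).trans ?_
      gcongr
    rw [e1]
    refine (seminorm_pow_le hmul _ hm).trans ?_
    refine pow_le_pow_left₀ (apply_nonneg _ _) ?_ m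
    rw [e2]
    calc _ ≤ _ := map_add_le_add p _ _
      _ ≤ (1 + C * (1 / m) ^ 2) + M * (R / m) ^ 2 := by
        refine add_le_add (hCt _) ((hpM _).trans ?_)
        gcongr
      _ = _ := by
        rw [hK]
        ring
  have lim : Filter.Tendsto (fun m : ℕ => Real.exp (K / m)) Filter.atTop (nhds 1) := by
    rw [← Real.exp_zero]
    exact (Real.continuous_exp.tendsto 0).comp (tendsto_const_div_atTop_nhds_zero_nat K)
  refine ge_of_tendsto lim ?_
  filter_upwards [Filter.eventually_ne_atTop 0, Filter.eventually_ge_atTop ⌈R⌉₊] with m hm hm'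
  refine (key m hm (Nat.ceil_le.1 hm')).trans ?_
  have hm0 : (0 : ℝ) < m := by positivity
  calc (1 + K * (1 / m) ^ 2) ^ m ≤ (Real.exp (K * (1 / m) ^ 2)) ^ m := by
        gcongr
        rw [add_comm]
        exact Real.add_one_le_exp _
    _ = Real.exp (K / m) := by
        rw [← Real.exp_nat_mul]
        congr 1
        field_simp

/-- A submultiplicative seminorm for which all selfadjoint elements are hermitian is bounded by the
C*-norm on selfadjoint elements. -/
theorem seminorm_le_norm_of_isSelfAdjoint {p : Seminorm ℂ B}
    (hmul : ∀ x y, p (x * y) ≤ p x * p y) {M : ℝ}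
    (hM : 0 ≤ M) (hpM : ∀ x, p x ≤ M * ‖x‖) (hp : ∀ h : B, IsSelfAdjoint h → IsHermitianFor p h)
    {a : B} (ha : IsSelfAdjoint a) : p a ≤ ‖a‖ := by
  have one : ∀ a : B, IsSelfAdjoint a → ‖a‖ ≤ 1 → p a ≤ 1 := by
    intro a ha h1
    have ha' : IsStarNormal a := ha.isStarNormal
    have b1 : ∀ s, |Real.arccos s| ≤ Real.pi := fun s => by
      rw [abs_of_nonneg (Real.arccos_nonneg s)]
      exact Real.arccos_le_pi s
    have h2 := seminorm_cfcExp_le hmul hM hpM hp Real.continuous_arccos b1 ha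
    have h3 := seminorm_cfcExp_le hmul hM hpM hp (θ := fun s => -Real.arccos s)
      Real.continuous_arccos.neg (R := Real.pi) (fun s => by rw [abs_neg]; exact b1 s) ha
    -- This is a = cos(arccos a). `Real.arccos` is continuous and bounded by π on the whole line, as
    -- the previous lemma demands, and inverts the cosine on [-1, 1], where the spectrum lies.
    have e : a = (1 / 2 : ℂ) • cfcExp Real.arccos a
        + (1 / 2 : ℂ) • cfcExp (fun s => -Real.arccos s) a := by
      conv_lhs => rw [← cfc_id ℂ a]
      rw [cfcExp, cfcExp, ← cfc_smul _ _ a (by fun_prop), ← cfc_smul _ _ a (by fun_prop),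
        ← cfc_add ..]
      refine cfc_congr fun z hz => ?_
      have hz1 : ‖z‖ ≤ 1 := by
        rcases subsingleton_or_nontrivial B with hB | hB
        · simp [spectrum.of_subsingleton] at hz
        · exact (spectrum.norm_le_norm_of_mem hz).trans h1
      have hre : (z.re : ℂ) = z := (ha.mem_spectrum_eq_re hz).symm
      have hab := abs_le.1 ((Complex.abs_re_le_norm z).trans hz1)
      have hc : Complex.cos (Real.arccos z.re : ℝ) = z := by
        rw [← Complex.ofReal_cos, Real.cos_arccos hab.1 hab.2, hre]
      simp only [id, smul_eq_mul]
      conv_lhs => rw [← hc, Complex.cos]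
      push_cast
      ring_nf
    rw [e]
    refine (map_add_le_add p _ _).trans ?_
    rw [map_smul_eq_mul, map_smul_eq_mul]
    norm_num
    linarith
  rcases (norm_nonneg a).eq_or_lt with h0 | h0
  · rw [norm_eq_zero.1 h0.symm]
    simp
  · have h1 := one ((((‖a‖)⁻¹ : ℝ) : ℂ) • a) (by
      rw [IsSelfAdjoint, star_smul, ha.star_eq]
      simp) (by
      rw [norm_smul, Complex.norm_real, Real.norm_of_nonneg (by positivity),
        inv_mul_cancel₀ h0.ne'])
    rw [map_smul_eq_mul, Complex.norm_real, Real.norm_of_nonneg (by positivity),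
      inv_mul_le_iff₀ h0, mul_one] at h1
    exact h1

end Hermitian

/-! The C*-algebra of a von Neumann algebra structure. -/

namespace VNAlgebra

variable {A : Type u} [AddCommGroup A] [Module ℂ A]

/-- A copy of `A` carrying the C*-algebra structure given by `S`. -/
def Alg (_ : VNAlgebra A) : Type u := A

section Instances

variable (S : VNAlgebra A)

instance : AddCommGroup S.Alg := inferInstanceAs (AddCommGroup A)

instance : Module ℂ S.Alg := inferInstanceAs (Module ℂ A)

instance [FiniteDimensional ℂ A] : FiniteDimensional ℂ S.Alg :=
  inferInstanceAs (FiniteDimensional ℂ A)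

/-- The identity map. -/
def toAlg : A ≃ₗ[ℂ] S.Alg := LinearEquiv.refl ℂ A

instance : NormedAddCommGroup S.Alg :=
  AddGroupNorm.toNormedAddCommGroup
    { S.norm.toAddGroupSeminorm with
      eq_zero_of_map_eq_zero' := S.eq_zero_of_norm_eq_zero }

instance : NormedRing S.Alg :=
  { (inferInstance : NormedAddCommGroup S.Alg) with
    mul := fun a b => S.mul a b
    one := S.one
    mul_assoc := fun a b c => (S.mul_assoc a b c).symm
    one_mul := S.one_mul
    mul_one := S.mul_one
    left_distrib := fun a b c => (S.mul a).map_add b c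
    right_distrib := fun a b c => LinearMap.congr_fun (S.mul.map_add a b) c
    zero_mul := fun a => LinearMap.congr_fun S.mul.map_zero a
    mul_zero := fun a => (S.mul a).map_zero
    norm_mul_le := S.norm_mul_le }

instance : StarRing S.Alg where
  star := S.star
  star_involutive := S.star_star
  star_mul := S.star_mul
  star_add := S.star.map_add

theorem norm_toAlg (a : A) : ‖S.toAlg a‖ = S.norm a := rfl

theorem toAlg_mul (a b : A) : S.toAlg (S.mul a b) = S.toAlg a * S.toAlg b := rfl

theorem toAlg_one : S.toAlg S.one = 1 := rfl

theorem toAlg_star (a : A) : S.toAlg (S.star a) = Star.star (S.toAlg a) := rfl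

instance : Algebra ℂ S.Alg :=
  Algebra.ofModule (fun c a b => LinearMap.congr_fun (S.mul.map_smul c a) b)
    (fun c a b => (S.mul a).map_smul c b)

instance : NormedAlgebra ℂ S.Alg where
  norm_smul_le c a := (map_smul_eq_mul S.norm c a).le

instance : CStarRing S.Alg where
  norm_mul_self_le a := by
    rw [← sq]
    exact (S.norm_star_mul_self a).ge

instance : StarModule ℂ S.Alg where
  star_smul c a := S.star.map_smulₛₗ c a

instance [FiniteDimensional ℂ A] : CompleteSpace S.Alg := FiniteDimensional.complete ℂ S.Alg

instance [FiniteDimensional ℂ A] : CStarAlgebra S.Alg where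

instance [FiniteDimensional ℂ A] : PartialOrder S.Alg := CStarAlgebra.spectralOrder S.Alg

instance [FiniteDimensional ℂ A] : StarOrderedRing S.Alg := CStarAlgebra.spectralOrderedRing S.Alg

end Instances

/-- The norm of a von Neumann algebra is determined by its multiplication and its involution, and
by any C*-algebra that it is isomorphic to. -/
theorem norm_eq_of_equiv [FiniteDimensional ℂ A] (S : VNAlgebra A) {B : Type u} [CStarAlgebra B]
    (f : A ≃ₗ[ℂ] B) (hmul : ∀ a b, f (S.mul a b) = f a * f b)
    (hstar : ∀ a, f (S.star a) = Star.star (f a)) (a : A) : S.norm a = ‖f a‖ := by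
  let g : S.Alg ≃⋆ₐ[ℂ] B :=
    { (f : A ≃ₗ[ℂ] B) with
      toFun := f
      invFun := f.symm
      map_mul' := hmul
      map_star' := hstar
      map_smul' := f.map_smul
      map_add' := f.map_add }
  -- *-isomorphisms of C*-algebras are isometric.
  exact (StarAlgEquiv.norm_map g (S.toAlg a)).symm

/-! Matrices. -/

/-- The C*-algebra `M_n(A)`. -/
abbrev MatAlg (S : VNAlgebra A) (n : ℕ) : Type u := CStarMatrix (Fin n) (Fin n) S.Alg

/-- The identity map from matrices to the C*-algebra of matrices. -/
def toMatAlg (S : VNAlgebra A) (n : ℕ) : Matrix (Fin n) (Fin n) A ≃ₗ[ℂ] S.MatAlg n :=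
  LinearEquiv.refl ℂ (Matrix (Fin n) (Fin n) A)

variable (S : VNAlgebra A)

theorem toMatAlg_apply {n : ℕ} (x : Matrix (Fin n) (Fin n) A) (i j : Fin n) :
    S.toMatAlg n x i j = S.toAlg (x i j) := rfl

/-- The product of matrices induced from `S`. -/
def matMul {m n p : ℕ} (x : Matrix (Fin m) (Fin n) A) (y : Matrix (Fin n) (Fin p) A) :
    Matrix (Fin m) (Fin p) A :=
  fun i j => ∑ k, S.mul (x i k) (y k j)

/-- The adjoint of matrices induced from `S`. -/
def matStar {m n : ℕ} (x : Matrix (Fin m) (Fin n) A) : Matrix (Fin n) (Fin m) A :=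
  fun i j => S.star (x j i)

theorem toMatAlg_matMul {n : ℕ} (x y : Matrix (Fin n) (Fin n) A) :
    S.toMatAlg n (S.matMul x y) = S.toMatAlg n x * S.toMatAlg n y := by
  ext i j
  rw [CStarMatrix.mul_apply]
  simp [toMatAlg_apply, matMul, map_sum, toAlg_mul]

theorem toMatAlg_matStar {n : ℕ} (x : Matrix (Fin n) (Fin n) A) :
    S.toMatAlg n (S.matStar x) = Star.star (S.toMatAlg n x) := rfl

theorem toMatAlg_one {n : ℕ} :
    S.toMatAlg n (Matrix.diagonal fun _ => S.one) = 1 := by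
  ext i j
  rw [CStarMatrix.one_apply, toMatAlg_apply, Matrix.diagonal_apply]
  split_ifs <;> simp [toAlg_one]

/-- The embedding of scalar matrices into `M_n(A)`. -/
def scalarHom (n : ℕ) : Matrix (Fin n) (Fin n) ℂ →⋆ₙₐ[ℂ] S.MatAlg n where
  toFun α := CStarMatrix.ofMatrix (α.map (algebraMap ℂ S.Alg))
  map_smul' c α := by
    ext i j
    change algebraMap ℂ S.Alg (c * α i j) = c • algebraMap ℂ S.Alg (α i j)
    rw [Algebra.smul_def, map_mul]
  map_zero' := by
    ext i j
    simp
  map_add' α β := by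
    ext i j
    simp
  map_mul' α β := by
    ext i j
    simp [Matrix.mul_apply, CStarMatrix.mul_apply]
  map_star' α := by
    ext i j
    exact algebraMap_star_comm (α j i)

/-- Scalars are central in `A`. This reduces Ruan's axiom on scalar matrices to submultiplicativity
and to contractivity of the *-homomorphism `scalarHom`. -/
theorem toMatAlg_sandwich {n : ℕ} (α : Matrix (Fin n) (Fin n) ℂ) (x : Matrix (Fin n) (Fin n) A)
    (β : Matrix (Fin n) (Fin n) ℂ) :
    S.toMatAlg n (sandwich α x β) = S.scalarHom n α * S.toMatAlg n x * S.scalarHom n β := by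
  ext i j
  have h : ∀ α i j, S.scalarHom n α i j = algebraMap ℂ S.Alg (α i j) := fun _ _ _ => rfl
  simp only [CStarMatrix.mul_apply, toMatAlg_apply, h, Finset.sum_mul, sandwich, map_sum, map_smul]
  rw [Finset.sum_comm]
  refine Finset.sum_congr rfl fun k _ => Finset.sum_congr rfl fun l _ => ?_
  rw [← Algebra.smul_def, ← Algebra.commutes, ← Algebra.smul_def, smul_smul, mul_comm]

/-- The block diagonal embedding of `M_m(A) × M_n(A)` into `M_{m+n}(A)`. -/
def dsumHom (m n : ℕ) : S.MatAlg m × S.MatAlg n →⋆ₙₐ[ℂ] S.MatAlg (m + n) where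
  toFun z := S.toMatAlg (m + n) (dsum ((S.toMatAlg m).symm z.1) ((S.toMatAlg n).symm z.2))
  map_smul' c z := by
    ext i j
    induction i using Fin.addCases <;> induction j using Fin.addCases <;>
      simp [toMatAlg_apply, dsum]
  map_zero' := by
    ext i j
    induction i using Fin.addCases <;> induction j using Fin.addCases <;>
      simp [toMatAlg_apply, dsum]
  map_add' z w := by
    ext i j
    induction i using Fin.addCases <;> induction j using Fin.addCases <;>
      simp [toMatAlg_apply, dsum]
  map_mul' z w := by
    obtain ⟨⟨x, y⟩, rfl⟩ := ((S.toMatAlg m).prodCongr (S.toMatAlg n)).surjective z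
    obtain ⟨⟨x', y'⟩, rfl⟩ := ((S.toMatAlg m).prodCongr (S.toMatAlg n)).surjective w
    simp only [LinearEquiv.prodCongr_apply, LinearEquiv.symm_apply_apply, Prod.mk_mul_mk,
      ← toMatAlg_matMul]
    congr 1
    ext i j
    induction i using Fin.addCases <;> induction j using Fin.addCases <;>
      simp [matMul, dsum, Fin.sum_univ_add]
  map_star' z := by
    obtain ⟨⟨x, y⟩, rfl⟩ := ((S.toMatAlg m).prodCongr (S.toMatAlg n)).surjective z
    simp only [LinearEquiv.prodCongr_apply, LinearEquiv.symm_apply_apply, Prod.star_def,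
      ← toMatAlg_matStar]
    congr 1
    ext i j
    induction i using Fin.addCases <;> induction j using Fin.addCases <;>
      simp [matStar, dsum]

theorem dsumHom_injective (m n : ℕ) : Function.Injective (S.dsumHom m n) := by
  refine (injective_iff_map_eq_zero _).2 fun z hz => ?_
  have h : ∀ i j, dsum ((S.toMatAlg m).symm z.1) ((S.toMatAlg n).symm z.2) i j = 0 := fun i j =>
    congrFun (congrFun hz i) j
  refine Prod.ext ?_ ?_
  · ext i j
    have h1 := h (Fin.castAdd n i) (Fin.castAdd n j)
    simp only [dsum, Matrix.reindex_apply, Matrix.submatrix_apply,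
      finSumFinEquiv_symm_apply_castAdd, Matrix.fromBlocks_apply₁₁] at h1
    exact h1
  · ext i j
    have h1 := h (Fin.natAdd m i) (Fin.natAdd m j)
    simp only [dsum, Matrix.reindex_apply, Matrix.submatrix_apply,
      finSumFinEquiv_symm_apply_natAdd, Matrix.fromBlocks_apply₂₂] at h1
    exact h1

/-! ### The canonical operator space structure and its uniqueness -/

variable [FiniteDimensional ℂ A]

/-- The C*-norm of `M_n(A)`. -/
def matNorm (n : ℕ) : Seminorm ℂ (Matrix (Fin n) (Fin n) A) :=
  (normSeminorm ℂ (S.MatAlg n)).comp (S.toMatAlg n).toLinearMap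

theorem matNorm_apply {n : ℕ} (x : Matrix (Fin n) (Fin n) A) :
    S.matNorm n x = ‖S.toMatAlg n x‖ := rfl

/-- The product C*-algebra has the maximum norm, and an injective *-homomorphism out of it is
isometric. -/
theorem matNorm_dsum {m n : ℕ} (x : Matrix (Fin m) (Fin m) A) (y : Matrix (Fin n) (Fin n) A) :
    S.matNorm (m + n) (dsum x y) = max (S.matNorm m x) (S.matNorm n y) :=
  NonUnitalStarAlgHom.norm_map (S.dsumHom m n) (S.dsumHom_injective m n)
    (S.toMatAlg m x, S.toMatAlg n y)

/-- The operator space structure given by the C*-norms of matrices. -/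
def canonical : OperatorSpaceStructure A where
  norm := S.matNorm
  eq_zero_of_norm_eq_zero n x h := by
    rw [matNorm_apply, norm_eq_zero] at h
    exact (S.toMatAlg n).map_eq_zero_iff.1 h
  norm_dsum _ _ x y := S.matNorm_dsum x y
  norm_sandwich_le n α x β := by
    rw [matNorm_apply, toMatAlg_sandwich]
    calc _ ≤ ‖S.scalarHom n α‖ * ‖S.toMatAlg n x‖ * ‖S.scalarHom n β‖ :=
          (_root_.norm_mul_le _ _).trans (mul_le_mul_of_nonneg_right (_root_.norm_mul_le _ _) (norm_nonneg _))
      _ ≤ ‖α‖ * ‖S.toMatAlg n x‖ * ‖β‖ := by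
          gcongr <;> exact NonUnitalStarAlgHom.norm_apply_le _ _

/-- The von Neumann algebra of matrices. -/
def mat (n : ℕ) : VNAlgebra (Matrix (Fin n) (Fin n) A) where
  mul := ((LinearMap.mul ℂ (S.MatAlg n)).compl₁₂ (S.toMatAlg n).toLinearMap
    (S.toMatAlg n).toLinearMap).compr₂ (S.toMatAlg n).symm.toLinearMap
  one := (S.toMatAlg n).symm 1
  star :=
    { toFun := S.matStar
      map_add' := fun x y => by
        ext i j
        simp [matStar]
      map_smul' := fun c x => by
        ext i j
        simp [matStar] }
  norm := S.matNorm n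
  eq_zero_of_norm_eq_zero := S.canonical.eq_zero_of_norm_eq_zero n
  mul_assoc a b c := by simp [_root_.mul_assoc]
  one_mul a := by simp
  mul_one a := by simp
  star_star a := by
    ext i j
    simp [matStar, S.star_star]
  star_mul a b := (S.toMatAlg n).injective (by
    change S.toMatAlg n (S.matStar _) = _
    simp [toMatAlg_matStar])
  norm_mul_le a b := by
    simpa [matNorm_apply] using _root_.norm_mul_le (S.toMatAlg n a) (S.toMatAlg n b)
  norm_star_mul_self a := by
    have h := CStarRing.norm_star_mul_self (x := S.toMatAlg n a)
    rw [sq, matNorm_apply S a, ← h, matNorm_apply]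
    change ‖S.toMatAlg n ((S.toMatAlg n).symm (S.toMatAlg n (S.matStar a) * _))‖ = _
    simp [toMatAlg_matStar]

theorem isCanonical_canonical : S.IsCanonical S.canonical := fun n => by
  refine ⟨S.mat n, fun x y i j => ?_, ?_, fun x i j => rfl, rfl⟩
  · have : (S.mat n).mul x y = S.matMul x y :=
      (S.toMatAlg n).injective (by simp [mat, toMatAlg_matMul])
    rw [this]
    rfl
  · exact (S.toMatAlg n).injective (by simp [mat, toMatAlg_one])

/-- Being canonical fixes the *-algebra `M_n(A)`, and a *-algebra has only one C*-norm. -/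
theorem IsCanonical.eq_canonical {S : VNAlgebra A} {E : OperatorSpaceStructure A}
    (h : S.IsCanonical E) : E = S.canonical := by
  ext n x
  obtain ⟨T, h1, -, h3, h4⟩ := h n
  rw [← h4]
  refine T.norm_eq_of_equiv (S.toMatAlg n) (fun x y => ?_) (fun x => ?_) x
  · rw [← toMatAlg_matMul]
    congr 1
    ext i j
    exact h1 x y i j
  · rw [← toMatAlg_matStar]
    congr 1
    ext i j
    exact h3 x i j

end VNAlgebra

/-! Norms of elementary tensors `α ⊗ b` in `M_n(X)`. -/

namespace OperatorSpaceStructure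

variable {X : Type u} [AddCommGroup X] [Module ℂ X] (E : OperatorSpaceStructure X)

theorem norm_one_eq_groundNorm (x : Matrix (Fin 1) (Fin 1) X) :
    E.norm 1 x = E.groundNorm (x 0 0) := by
  change _ = E.norm 1 (fun _ _ => x 0 0)
  congr 1
  ext i j
  rw [Subsingleton.elim i 0, Subsingleton.elim j 0]

theorem norm_diagonal_le (b : X) (n : ℕ) :
    E.norm n (Matrix.diagonal fun _ => b) ≤ E.groundNorm b := by
  induction n with
  | zero =>
    rw [Subsingleton.elim (Matrix.diagonal fun _ : Fin 0 => b) 0, map_zero]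
    exact apply_nonneg _ _
  | succ n ih =>
    have e : (Matrix.diagonal fun _ : Fin (n + 1) => b)
        = dsum (Matrix.diagonal fun _ : Fin n => b) (Matrix.diagonal fun _ : Fin 1 => b) := by
      ext i j
      induction i using Fin.addCases <;> induction j using Fin.addCases <;>
        simp [dsum, Matrix.diagonal_apply, Fin.ext_iff] <;> omega
    rw [e, E.norm_dsum, norm_one_eq_groundNorm E]
    simpa using ih

theorem norm_map_smul_le {n : ℕ} (α : Matrix (Fin n) (Fin n) ℂ) (b : X) :
    E.norm n (α.map fun c => c • b) ≤ ‖α‖ * E.groundNorm b := by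
  have e : α.map (fun c => c • b) = sandwich α (Matrix.diagonal fun _ => b) 1 := by
    ext i j
    simp [sandwich, Matrix.one_apply, Matrix.diagonal_apply]
  rw [e]
  refine (E.norm_sandwich_le _ _ _ _).trans ?_
  have h1 := norm_one_le n
  have h2 := E.norm_diagonal_le b n
  calc _ ≤ ‖α‖ * E.groundNorm b * 1 := by gcongr
    _ = _ := mul_one _

/-- For the lower bound, compress α ⊗ b by the row (αv)* and the column v. The result is ‖αv‖² b, so
‖αv‖² ‖b‖ ≤ ‖αv‖ N ‖v‖ with N the norm of α ⊗ b, and hence ‖α‖ ≤ N / ‖b‖. -/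
theorem norm_map_smul {n : ℕ} (α : Matrix (Fin n) (Fin n) ℂ) (b : X) :
    E.norm n (α.map fun c => c • b) = ‖α‖ * E.groundNorm b := by
  refine le_antisymm (E.norm_map_smul_le α b) ?_
  set N := E.norm n (α.map fun c => c • b) with hN
  have hN0 : 0 ≤ N := apply_nonneg _ _
  rcases (apply_nonneg E.groundNorm b).eq_or_lt with h0 | h0
  · rwa [← h0, mul_zero]
  rw [← le_div_iff₀ h0]
  refine opNorm_le_of (by positivity) fun v => ?_
  have colnorm : ∀ w : Fin n → ℂ, ‖Matrix.replicateCol (Fin 1) w‖ ≤ √(∑ k, ‖w k‖ ^ 2) := by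
    intro w
    refine opNorm_le_of (Real.sqrt_nonneg _) fun z => ?_
    rw [Real.sq_sqrt (by positivity), Finset.sum_mul]
    refine Finset.sum_le_sum fun k _ => ?_
    simp [Matrix.mulVec, dotProduct, mul_pow]
  set S := ∑ i, ‖(α *ᵥ v) i‖ ^ 2 with hS
  have hS0 : 0 ≤ S := by positivity
  set V := ∑ i, ‖v i‖ ^ 2 with hV
  have hV0 : 0 ≤ V := by positivity
  have h1 := E.norm_sandwich_le' (Matrix.replicateCol (Fin 1) (α *ᵥ v))ᴴ (α.map fun c => c • b)
    (Matrix.replicateCol (Fin 1) v)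
  have e : sandwich (Matrix.replicateCol (Fin 1) (α *ᵥ v))ᴴ (α.map fun c => c • b)
      (Matrix.replicateCol (Fin 1) v) 0 0 = (S : ℂ) • b := by
    simp only [sandwich, Matrix.conjTranspose_apply, Matrix.replicateCol_apply, Matrix.map_apply,
      smul_smul, ← Finset.sum_smul]
    congr 1
    rw [hS, Complex.ofReal_sum]
    refine Finset.sum_congr rfl fun k _ => ?_
    have : ((‖(α *ᵥ v) k‖ ^ 2 : ℝ) : ℂ) = star ((α *ᵥ v) k) * (α *ᵥ v) k := by
      rw [Complex.ofReal_pow]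
      exact (Complex.conj_mul' _).symm
    rw [this]
    conv_rhs => rw [Matrix.mulVec, dotProduct, Finset.mul_sum]
    refine Finset.sum_congr rfl fun l _ => ?_
    rw [Matrix.mulVec, dotProduct]
    ring
  rw [norm_one_eq_groundNorm, e, map_smul_eq_mul, Complex.norm_real, Real.norm_of_nonneg hS0,
    Matrix.l2_opNorm_conjTranspose, ← hN] at h1
  have h2 : S * E.groundNorm b ≤ √S * N * √V :=
    h1.trans (mul_norm_mul_le (norm_nonneg _) hN0 (norm_nonneg _) (colnorm _) (colnorm _))
  have h3 : √S * E.groundNorm b ≤ N * √V := by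
    rcases (Real.sqrt_nonneg S).eq_or_lt with h | h
    · rw [← h, zero_mul]
      positivity
    · refine le_of_mul_le_mul_left ?_ h
      rw [← mul_assoc, ← mul_assoc, Real.mul_self_sqrt hS0]
      exact h2
  rw [div_pow, div_mul_eq_mul_div, le_div_iff₀ (by positivity)]
  calc S * E.groundNorm b ^ 2 = (√S * E.groundNorm b) ^ 2 := by rw [mul_pow, Real.sq_sqrt hS0]
    _ ≤ (N * √V) ^ 2 := by gcongr
    _ = _ := by rw [mul_pow, Real.sq_sqrt hV0]

/-- A map `ℂ → X` is a complete isometry if it is isometric. -/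
theorem isCompleteIsometry_iff (a : ℂ →ₗ[ℂ] X) :
    IsCompleteIsometry complex E a ↔ E.groundNorm (a 1) = 1 := by
  have ha : ∀ c, a c = c • a 1 := fun c => by rw [← map_smul, smul_eq_mul, mul_one]
  have h : ∀ (n : ℕ) (α : Matrix (Fin n) (Fin n) ℂ), E.norm n (α.map a) = ‖α‖ * E.groundNorm (a 1) :=
    fun n α => by
      rw [← norm_map_smul]
      congr 1
      ext i j
      exact ha _
  constructor
  · intro hi
    have h1 := hi 1 1
    rw [h] at h1
    change _ = ‖(1 : Matrix (Fin 1) (Fin 1) ℂ)‖ at h1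
    rwa [norm_one, one_mul] at h1
  · intro h1 n α
    rw [h, h1, mul_one]
    rfl

theorem groundNorm_opp (x : X) : E.opp.groundNorm x = E.groundNorm x := rfl

end OperatorSpaceStructure

open OperatorSpaceStructure

/-- Together with `isCompleteIsometry_iff` this turns condition 4 into: ‖a‖ = 1 implies ‖a*a‖ = 1.
-/
theorem starMulSelf_one {A : Type u} [AddCommGroup A] [Module ℂ A] (μ : A ⊗[ℂ] A →ₗ[ℂ] A)
    (i : Conj A →ₗ[ℂ] A) (a : ℂ →ₗ[ℂ] A) :
    starMulSelf μ i a 1 = μ (i (Conj.mk (a 1)) ⊗ₜ[ℂ] a 1) := rfl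

/-! ### From a C*-algebra to a monoid for the Haagerup tensor product -/

namespace VNAlgebra

variable {A : Type u} [AddCommGroup A] [Module ℂ A] (S : VNAlgebra A)

/-- A submultiplicative operator space structure makes the multiplication a complete contraction
on the Haagerup tensor product. -/
theorem isCompleteContraction_mul [FiniteDimensional ℂ A] {E : OperatorSpaceStructure A}
    (hE : ∀ (n : ℕ) (x y : Matrix (Fin n) (Fin n) A),
      E.norm n (S.matMul x y) ≤ E.norm n x * E.norm n y) :
    IsCompleteContraction (E.haagerup E) E (TensorProduct.lift S.mul) := by
  intro n v
  change _ ≤ haagerupNorm E E n v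
  refine le_of_forall_gt_imp_ge_of_dense fun C hC => ?_
  obtain ⟨r, x, y, rfl, hlt⟩ := exists_lt_of_haagerupNorm_lt E E hC
  refine le_trans ?_ hlt.le
  have inf := Fin.castAdd_injective n r
  have ing := Fin.natAdd_injective r n
  -- The hypothesis concerns square matrices only, so x and y are placed as opposite off-diagonal
  -- blocks of matrices of size n + r. The upper left block of x'y' is then the image of x ⊙ y.
  set x' := sandwich (incl (Fin.castAdd r)) x (incl (Fin.natAdd n))ᵀ with hx'
  set y' := sandwich (incl (Fin.natAdd n)) y (incl (Fin.castAdd r))ᵀ with hy'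
  have e : (matrixInner x y).map (TensorProduct.lift S.mul)
      = sandwich (incl (Fin.castAdd r))ᵀ (S.matMul x' y') (incl (Fin.castAdd r)) := by
    ext i j
    have e1 : ∀ k : Fin n, x' (Fin.castAdd r i) (Fin.castAdd r k) = 0 := fun k =>
      sandwich_incl_eq_zero _ _ _ _ _ (Or.inr fun l h => by
        have := congrArg Fin.val h
        simp at this
        omega)
    have e2 : ∀ k : Fin r, x' (Fin.castAdd r i) (Fin.natAdd n k) = x i k := fun k =>
      sandwich_incl_apply _ _ inf ing x i k
    have e3 : ∀ k : Fin r, y' (Fin.natAdd n k) (Fin.castAdd r j) = y k j := fun k =>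
      sandwich_incl_apply _ _ ing inf y k j
    have e4 : sandwich (incl (Fin.castAdd r))ᵀ (S.matMul x' y') (incl (Fin.castAdd r)) i j
        = S.matMul x' y' (Fin.castAdd r i) (Fin.castAdd r j) := by
      simp [sandwich, incl_apply]
    rw [e4, matMul, Fin.sum_univ_add]
    simp only [e1, e2, e3]
    simp [matrixInner, map_sum]
  have bd : ∀ {p q m k : ℕ} {f : Fin p → Fin m} {g : Fin q → Fin k} (hf : f.Injective)
      (hg : g.Injective) (z : Matrix (Fin p) (Fin q) A),
      E.rectNorm (sandwich (incl f) z (incl g)ᵀ) ≤ E.rectNorm z := by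
    intro p q m k f g hf hg z
    refine (E.rectNorm_sandwich_le _ _ _).trans ((mul_norm_mul_le (norm_nonneg _)
      (E.rectNorm_nonneg z) (norm_nonneg _) (norm_incl_le hf)
      (norm_incl_transpose_le hg)).trans ?_)
    simp
  rw [e]
  refine (E.norm_sandwich_le' _ _ _).trans ((mul_norm_mul_le (norm_nonneg _)
    (apply_nonneg _ _) (norm_nonneg _) (norm_incl_transpose_le inf) (norm_incl_le inf)).trans ?_)
  rw [_root_.one_mul, _root_.mul_one]
  refine (hE _ x' y').trans ?_
  rw [← rectNorm_square, ← rectNorm_square]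
  exact mul_le_mul (bd inf ing x) (bd ing inf y) (E.rectNorm_nonneg _) (E.rectNorm_nonneg _)

/-- The unit is selfadjoint, so ‖1‖ = ‖1‖². Equality with 1 fails when `A` is zero. -/
theorem norm_unit_le : S.norm S.one ≤ 1 := by
  have h := S.norm_star_mul_self S.one
  have h1 : S.star S.one = S.one := by
    have := S.star_mul (S.star S.one) S.one
    rw [S.mul_one, S.star_star, S.mul_one] at this
    exact this.symm
  rw [h1, S.one_mul] at h
  nlinarith [apply_nonneg S.norm S.one]

variable [FiniteDimensional ℂ A]

/-- The map a ↦ [a] is a *-isomorphism onto `M_1(A)`, hence isometric. -/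
theorem groundNorm_canonical : S.canonical.groundNorm = S.norm := by
  ext a
  let f : A ≃ₗ[ℂ] S.MatAlg 1 :=
    { toFun := fun a => S.toMatAlg 1 (fun _ _ => a)
      invFun := fun x => (S.toMatAlg 1).symm x 0 0
      map_add' := fun _ _ => rfl
      map_smul' := fun _ _ => rfl
      left_inv := fun _ => rfl
      right_inv := fun x => by
        ext i j
        rw [Subsingleton.elim i 0, Subsingleton.elim j 0]
        rfl }
  refine (S.norm_eq_of_equiv f (fun a b => ?_) (fun a => rfl) a).symm
  refine Eq.trans ?_ (S.toMatAlg_matMul (fun _ _ => a : Matrix (Fin 1) (Fin 1) A) fun _ _ => b)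
  refine congrArg (S.toMatAlg 1) (?_ : (fun _ _ => S.mul a b) = _)
  ext i j
  simp [matMul]

/-- The categorical von Neumann algebra of a von Neumann algebra. -/
def toHaagerup : HaagerupVNAlgebra A where
  oss := S.canonical
  mul := TensorProduct.lift S.mul
  unit := LinearMap.toSpanSingleton ℂ A S.one
  inv := S.star.comp Conj.out
  mul_contraction := S.isCompleteContraction_mul fun n x y => by
    change ‖S.toMatAlg n (S.matMul x y)‖ ≤ _
    rw [toMatAlg_matMul]
    exact _root_.norm_mul_le _ _
  unit_contraction n α := by
    refine (S.canonical.norm_map_smul_le α S.one).trans ?_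
    rw [groundNorm_canonical]
    exact (mul_le_mul_of_nonneg_left S.norm_unit_le (norm_nonneg _)).trans (_root_.mul_one _).le
  inv_contraction n x := by
    change ‖S.toMatAlg n (S.matStar (x.map Conj.out))‖ ≤ ‖S.toMatAlg n (x.map Conj.out)‖
    rw [toMatAlg_matStar, norm_star]
  mul_assoc := TensorProduct.ext_threefold fun a b c => (S.mul_assoc a b c).symm
  one_mul := TensorProduct.ext' fun c a => by
    simp [S.one_mul]
  mul_one := TensorProduct.ext' fun a c => by
    simp [S.mul_one]
  involution := LinearMap.ext fun a => S.star_star a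
  reverse_multiplicative := TensorProduct.ext' fun a b => S.star_mul a b
  cstar_identity a ha := by
    rw [isCompleteIsometry_iff, groundNorm_canonical] at ha
    rw [isCompleteIsometry_iff, groundNorm_opp, groundNorm_canonical, starMulSelf_one]
    change S.norm (S.mul (S.star (a 1)) (a 1)) = 1
    rw [S.norm_star_mul_self, ha, one_pow]

theorem corresponds_toHaagerup : S.Corresponds S.toHaagerup where
  mul_eq _ _ := rfl
  unit_eq := one_smul ℂ S.one
  inv_eq _ := rfl
  norm_eq := S.groundNorm_canonical
  canonical := S.isCanonical_canonical

variable {S}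

theorem Corresponds.eq_toHaagerup {C : HaagerupVNAlgebra A} (h : S.Corresponds C) :
    C = S.toHaagerup := by
  refine HaagerupVNAlgebra.ext h.canonical.eq_canonical (TensorProduct.ext' h.mul_eq) ?_ ?_
  · refine LinearMap.ext_ring ?_
    rw [h.unit_eq]
    exact (one_smul ℂ S.one).symm
  · exact LinearMap.ext h.inv_eq

theorem Corresponds.eq {T : VNAlgebra A} {C : HaagerupVNAlgebra A} (h : S.Corresponds C)
    (h' : T.Corresponds C) : S = T := by
  refine VNAlgebra.ext ?_ ?_ ?_ (h.norm_eq.symm.trans h'.norm_eq)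
  · exact LinearMap.ext₂ fun a b => (h.mul_eq a b).symm.trans (h'.mul_eq a b)
  · exact h.unit_eq.symm.trans h'.unit_eq
  · exact LinearMap.ext fun a => (h.inv_eq a).symm.trans (h'.inv_eq a)

end VNAlgebra

/-! ### Comparison of matrix norms that share a ground norm -/

namespace OperatorSpaceStructure

variable {X : Type u} [AddCommGroup X] [Module ℂ X] (E : OperatorSpaceStructure X)

theorem groundNorm_entry_le {n : ℕ} (x : Matrix (Fin n) (Fin n) X) (i j : Fin n) :
    E.groundNorm (x i j) ≤ E.norm n x := by
  have hi : ∀ i : Fin n, Function.Injective fun _ : Fin 1 => i := fun i _ _ _ =>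
    Subsingleton.elim _ _
  have e : x i j = sandwich (incl fun _ : Fin 1 => i)ᵀ x (incl fun _ : Fin 1 => j) 0 0 := by
    simp [sandwich, incl_apply]
  rw [e, ← norm_one_eq_groundNorm]
  refine (E.norm_sandwich_le' _ _ _).trans ((mul_norm_mul_le (norm_nonneg _)
    (apply_nonneg _ _) (norm_nonneg _) (norm_incl_transpose_le (hi i)) (norm_incl_le (hi j))).trans
      ?_)
  simp

theorem norm_le_sum {n : ℕ} (x : Matrix (Fin n) (Fin n) X) :
    E.norm n x ≤ ∑ i, ∑ j, E.groundNorm (x i j) := by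
  have hi : ∀ i : Fin n, Function.Injective fun _ : Fin 1 => i := fun i _ _ _ =>
    Subsingleton.elim _ _
  have single : ∀ i j, E.norm n (Matrix.single i j (x i j)) ≤ E.groundNorm (x i j) := by
    intro i j
    have e : Matrix.single i j (x i j) = sandwich (incl fun _ : Fin 1 => i) (fun _ _ => x i j)
        (incl fun _ : Fin 1 => j)ᵀ := by
      ext k l
      by_cases h1 : k = i <;> by_cases h2 : l = j <;>
        simp [sandwich, incl_apply, h1, h2, eq_comm (a := i), eq_comm (a := j)]
    rw [e]
    refine (E.norm_sandwich_le' _ _ _).trans ((mul_norm_mul_le (norm_nonneg _)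
      (apply_nonneg _ _) (norm_nonneg _) (norm_incl_le (hi i))
      (norm_incl_transpose_le (hi j))).trans ?_)
    rw [one_mul, mul_one]
    exact (norm_one_eq_groundNorm E _).le
  conv_lhs => rw [Matrix.matrix_eq_sum_single x]
  refine (Finset.le_sum_of_subadditive (E.norm n) (map_zero (E.norm n)).le (map_add_le_add _) _ _).trans ?_
  refine Finset.sum_le_sum fun i _ => ?_
  refine (Finset.le_sum_of_subadditive (E.norm n) (map_zero (E.norm n)).le (map_add_le_add _) _ _).trans ?_
  exact Finset.sum_le_sum fun j _ => single i j

/-- A matrix is the sum of its n² entries placed singly, and each entry is a compression of it. The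
size of the constant never matters: it bounds a remainder in one inequality and disappears under
roots in the other. -/
theorem norm_le_mul_norm {F : OperatorSpaceStructure X} (h : E.groundNorm = F.groundNorm) {n : ℕ}
    (x : Matrix (Fin n) (Fin n) X) : E.norm n x ≤ (n * n : ℝ) * F.norm n x := by
  refine (E.norm_le_sum x).trans ?_
  rw [h]
  refine (Finset.sum_le_sum fun i _ => Finset.sum_le_sum fun j _ =>
    F.groundNorm_entry_le x i j).trans (le_of_eq ?_)
  simp [mul_assoc]

end OperatorSpaceStructure

/-! The operator space structure of a categorical von Neumann algebra is the canonical one. -/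

/-- If a > b > 0, the powers of a/b are unbounded. Exponents 2^k suffice, and they are those for
which a selfadjoint element satisfies ‖y^m‖ = ‖y‖^m by iterating the C*-identity. -/
theorem le_of_forall_pow_two_pow_le {a b M : ℝ} (hb : 0 ≤ b)
    (h : ∀ k : ℕ, a ^ 2 ^ k ≤ M * b ^ 2 ^ k) : a ≤ b := by
  by_contra! hab
  have ha : 0 < a := hb.trans_lt hab
  rcases hb.eq_or_lt with rfl | hb
  · have := h 0
    simp at this
    linarith
  · obtain ⟨k, hk⟩ := pow_unbounded_of_one_lt M ((one_lt_div hb).2 hab)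
    have h1 : (a / b) ^ 2 ^ k ≤ M := by
      rw [div_pow, div_le_iff₀ (by positivity)]
      exact h k
    have h2 : (a / b) ^ k ≤ (a / b) ^ 2 ^ k :=
      pow_le_pow_right₀ ((one_lt_div hb).2 hab).le Nat.lt_two_pow_self.le
    linarith

namespace VNAlgebra

variable {A : Type u} [AddCommGroup A] [Module ℂ A] (S : VNAlgebra A)

/-- As a is selfadjoint, the linear terms cancel in (1 + ita)*(1 + ita) = 1 + t²a². The C*-identity
bounds the square of the norm, and y² ≤ 1 + c implies y ≤ 1 + c for c ≥ 0. -/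
theorem norm_one_add_smul_le {a : A} (ha : S.star a = a) (t : ℝ) :
    S.norm (S.one + (t * Complex.I) • a) ≤ 1 + S.norm a ^ 2 * t ^ 2 := by
  have h := S.norm_star_mul_self (S.one + (t * Complex.I) • a)
  have e : S.toAlg (S.mul (S.star (S.one + (t * Complex.I) • a)) (S.one + (t * Complex.I) • a))
      = 1 + ((t ^ 2 : ℝ) : ℂ) • (S.toAlg a * S.toAlg a) := by
    have hs : Star.star (S.toAlg a) = S.toAlg a := ha
    rw [toAlg_mul, toAlg_star, map_add, map_smul, toAlg_one, star_add, star_one, star_smul, hs]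
    simp only [star_mul', Complex.star_def, Complex.conj_ofReal, Complex.conj_I, add_mul, mul_add,
      _root_.one_mul, _root_.mul_one, smul_mul_assoc, mul_smul_comm]
    have : (t : ℂ) * Complex.I * (t * -Complex.I) = ((t ^ 2 : ℝ) : ℂ) := by
      push_cast
      linear_combination (-(t : ℂ) ^ 2) * Complex.I_sq
    rw [← this]
    module
  rw [← norm_toAlg, e] at h
  have h1 : ‖(1 : S.Alg) + ((t ^ 2 : ℝ) : ℂ) • (S.toAlg a * S.toAlg a)‖
      ≤ 1 + S.norm a ^ 2 * t ^ 2 := by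
    refine (norm_add_le _ _).trans (add_le_add S.norm_unit_le ?_)
    rw [norm_smul, Complex.norm_real, Real.norm_of_nonneg (sq_nonneg t), mul_comm]
    refine mul_le_mul_of_nonneg_right ?_ (sq_nonneg t)
    rw [sq]
    exact _root_.norm_mul_le _ _
  rw [h] at h1
  have h2 : 0 ≤ S.norm a ^ 2 * t ^ 2 := by positivity
  nlinarith [apply_nonneg S.norm (S.one + (t * Complex.I) • a)]

/-- The rank one matrix `v v^*` tensored with `a`. -/
def rankOne {n : ℕ} (v : Fin n → ℂ) (a : A) : Matrix (Fin n) (Fin n) A :=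
  fun i j => (v i * Star.star (v j)) • a

variable {S}

/-- With P = 1 - vv*, the scalar row α = [v, P] satisfies αα* = vv* + P = 1. Compressing (1 + ita) ⊕
1 by α gives vv* ⊗ (1 + ita) + P ⊗ 1 = 1 + it(vv* ⊗ a), so Ruan's axioms carry the bound from the
ground level to `M_n(A)`. -/
theorem norm_one_add_rankOne_le {E : OperatorSpaceStructure A} (hE : E.groundNorm = S.norm)
    {a : A} (ha : S.star a = a) {n : ℕ} {v : Fin n → ℂ} (hv : ∑ i, Star.star (v i) * v i = 1) (t : ℝ) :
    E.norm n (Matrix.diagonal (fun _ => S.one) + (t * Complex.I) • rankOne v a)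
      ≤ 1 + S.norm a ^ 2 * t ^ 2 := by
  let P : Matrix (Fin n) (Fin n) ℂ := 1 - Matrix.vecMulVec v (Star.star v)
  have hV : Matrix.vecMulVec v (Star.star v) * Matrix.vecMulVec v (Star.star v)
      = Matrix.vecMulVec v (Star.star v) := by
    rw [Matrix.vecMulVec_mul_vecMulVec]
    have : Star.star v ⬝ᵥ v = 1 := hv
    rw [this]
    simp
  have hPs : Pᴴ = P := by
    simp [P, Matrix.conjTranspose_vecMulVec]
  have hP : P * Pᴴ = P := by
    rw [hPs]
    simp [P, sub_mul, mul_sub, hV]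
  let α : Matrix (Fin n) (Fin (1 + n)) ℂ :=
    Matrix.of fun i => Fin.append (fun _ => v i) (P i)
  have e1 : ∀ i j, ∑ k, P i k * Star.star (P j k) = P i j := fun i j => congrFun (congrFun hP i) j
  have hα : α * αᴴ = 1 := by
    ext i j
    rw [Matrix.mul_apply, Fin.sum_univ_add]
    simp only [α, Matrix.conjTranspose_apply, Matrix.of_apply, Fin.append_left, Fin.append_right, e1]
    simp [P, Matrix.vecMulVec_apply]
  have hα1 : ‖αᴴ‖ ≤ 1 := by
    have h1 := Matrix.l2_opNorm_conjTranspose_mul_self αᴴ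
    rw [Matrix.conjTranspose_conjTranspose, hα] at h1
    nlinarith [norm_one_le n, norm_nonneg αᴴ]
  have e : Matrix.diagonal (fun _ => S.one) + (t * Complex.I) • rankOne v a
      = sandwich α (dsum (Matrix.diagonal fun _ : Fin 1 => S.one + (t * Complex.I) • a)
        (Matrix.diagonal fun _ : Fin n => S.one)) αᴴ := by
    ext i j
    have e2 : sandwich α (dsum (Matrix.diagonal fun _ : Fin 1 => S.one + (t * Complex.I) • a)
        (Matrix.diagonal fun _ : Fin n => S.one)) αᴴ i j
        = (v i * Star.star (v j)) • (S.one + (t * Complex.I) • a)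
          + (∑ k, P i k * Star.star (P j k)) • S.one := by
      simp only [sandwich, Fin.sum_univ_add, α, Matrix.conjTranspose_apply, Matrix.of_apply,
        Fin.append_left, Fin.append_right, Finset.sum_smul]
      simp [dsum, Matrix.diagonal_apply]
    rw [e2, e1]
    simp only [Matrix.add_apply, Matrix.smul_apply, rankOne, P, Matrix.sub_apply,
      Matrix.vecMulVec_apply, Matrix.diagonal_apply, Matrix.one_apply, Pi.star_apply]
    split_ifs <;> module
  rw [e]
  refine (E.norm_sandwich_le' _ _ _).trans ((mul_norm_mul_le (norm_nonneg _) (apply_nonneg _ _)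
    (norm_nonneg _) ((Matrix.l2_opNorm_conjTranspose α).symm.le.trans hα1) hα1).trans ?_)
  rw [_root_.one_mul, _root_.mul_one, E.norm_dsum]
  refine max_le ((E.norm_diagonal_le _ _).trans ?_) ((E.norm_diagonal_le _ _).trans ?_)
  · rw [hE]
    exact S.norm_one_add_smul_le ha t
  · rw [hE]
    exact S.norm_unit_le.trans (le_add_of_nonneg_right (by positivity))

/-- The seminorm on the C*-algebra `M_n(A)` given by an operator space structure on `A`. -/
def matSeminorm (S : VNAlgebra A) (E : OperatorSpaceStructure A) (n : ℕ) :
    Seminorm ℂ (S.MatAlg n) :=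
  (E.norm n).comp (S.toMatAlg n).symm.toLinearMap

theorem matSeminorm_toMatAlg {E : OperatorSpaceStructure A} {n : ℕ} (x : Matrix (Fin n) (Fin n) A) :
    S.matSeminorm E n (S.toMatAlg n x) = E.norm n x := rfl

theorem matSeminorm_mul_le {E : OperatorSpaceStructure A}
    (hmul : ∀ (n : ℕ) (x y : Matrix (Fin n) (Fin n) A),
    E.norm n (S.matMul x y) ≤ E.norm n x * E.norm n y) {n : ℕ} (x y : S.MatAlg n) :
    S.matSeminorm E n (x * y) ≤ S.matSeminorm E n x * S.matSeminorm E n y := by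
  obtain ⟨x, rfl⟩ := (S.toMatAlg n).surjective x
  obtain ⟨y, rfl⟩ := (S.toMatAlg n).surjective y
  rw [← toMatAlg_matMul]
  exact hmul n x y

variable [FiniteDimensional ℂ A]

theorem isHermitianFor_rankOne {E : OperatorSpaceStructure A} (hE : E.groundNorm = S.norm)
    {a : A} (ha : S.star a = a) {n : ℕ} (v : Fin n → ℂ) :
    IsHermitianFor (S.matSeminorm E n) (S.toMatAlg n (rankOne v a)) := by
  have unit : ∀ w : Fin n → ℂ, ∑ i, Star.star (w i) * w i = 1 →
      IsHermitianFor (S.matSeminorm E n) (S.toMatAlg n (rankOne w a)) := by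
    intro w hw
    refine ⟨S.norm a ^ 2, by positivity, fun t => ?_⟩
    rw [← toMatAlg_one, ← map_smul, ← map_add, matSeminorm_toMatAlg]
    exact norm_one_add_rankOne_le hE ha hw t
  have zero : IsHermitianFor (S.matSeminorm E n) 0 := by
    refine ⟨0, le_rfl, fun t => ?_⟩
    rw [smul_zero, add_zero, zero_mul, add_zero, ← toMatAlg_one, matSeminorm_toMatAlg]
    refine (E.norm_diagonal_le _ _).trans ?_
    rw [hE]
    exact S.norm_unit_le
  set N := ∑ i, ‖v i‖ ^ 2 with hN
  have hN0 : 0 ≤ N := by positivity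
  have hNv : ∑ i, Star.star (v i) * v i = (N : ℂ) := by
    rw [hN, Complex.ofReal_sum]
    refine Finset.sum_congr rfl fun i _ => ?_
    rw [Complex.ofReal_pow]
    exact Complex.conj_mul' _
  rcases hN0.eq_or_lt with h0 | h0
  · have hv : ∀ i, v i = 0 := fun i => by
      have := (Finset.sum_eq_zero_iff_of_nonneg (fun i _ => sq_nonneg ‖v i‖)).1 h0.symm i
        (Finset.mem_univ i)
      simpa using this
    have e : rankOne v a = 0 := by
      ext i j
      simp [rankOne, hv]
    rw [e, map_zero]
    exact zero
  · have hs : ((√N : ℝ) : ℂ) * ((√N : ℝ) : ℂ) = N := by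
      rw [← Complex.ofReal_mul, Real.mul_self_sqrt hN0]
    have hs0 : ((√N : ℝ) : ℂ) ≠ 0 := by
      exact_mod_cast (Real.sqrt_pos.2 h0).ne'
    -- vv* is N times the rank one matrix of the unit vector v/√N, and real multiples of hermitian
    -- elements are hermitian.
    have h1 := (unit (fun i => ((√N : ℝ) : ℂ)⁻¹ * v i) (by
      have : ∀ i, Star.star (((√N : ℝ) : ℂ)⁻¹ * v i) * (((√N : ℝ) : ℂ)⁻¹ * v i)
          = (((√N : ℝ) : ℂ)⁻¹ * ((√N : ℝ) : ℂ)⁻¹) * (Star.star (v i) * v i) := fun i => by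
        simp only [star_mul', star_inv₀, Complex.star_def, Complex.conj_ofReal]
        ring
      simp only [this, ← Finset.mul_sum]
      rw [hNv, ← hs]
      field_simp)).smul N
    rw [← map_smul] at h1
    convert h1 using 2
    ext i j
    simp only [rankOne, Matrix.smul_apply, smul_smul, star_mul', star_inv₀, Complex.star_def,
      Complex.conj_ofReal]
    congr 1
    rw [← hs]
    field_simp

/-- The form x + x* is additive in x, so induction over matrix units applies, and every selfadjoint
matrix is half of such a sum. -/
theorem isHermitianFor_add_star {E : OperatorSpaceStructure A} (hE : E.groundNorm = S.norm)
    {n : ℕ} (x : Matrix (Fin n) (Fin n) A) :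
    IsHermitianFor (S.matSeminorm E n) (S.toMatAlg n (x + S.matStar x)) := by
  induction x using Matrix.induction_on' with
  | h_zero =>
    have e : (0 : Matrix (Fin n) (Fin n) A) + S.matStar 0 = rankOne 0 0 := by
      ext i j
      simp [matStar, rankOne]
    rw [e]
    exact isHermitianFor_rankOne hE (map_zero _) 0
  | h_add x y hx hy =>
    have e : x + y + S.matStar (x + y) = (x + S.matStar x) + (y + S.matStar y) := by
      ext i j
      simp only [matStar, Matrix.add_apply, map_add]
      abel
    rw [e, map_add]
    exact hx.add hy
  | h_std_basis i j a =>
    obtain ⟨b, c, hb, hc, rfl⟩ : ∃ b c, S.star b = b ∧ S.star c = c ∧ a = b + Complex.I • c := by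
      refine ⟨(1 / 2 : ℂ) • (a + S.star a), (-Complex.I / 2) • (a - S.star a), ?_, ?_, ?_⟩
      · simp only [map_smulₛₗ, map_add, S.star_star, map_div₀, map_one, map_ofNat]
        module
      · simp only [map_smulₛₗ, map_sub, S.star_star]
        simp only [map_div₀, map_neg, Complex.conj_I, map_ofNat]
        module
      · rw [smul_smul, mul_div_assoc', mul_neg, Complex.I_mul_I]
        module
    let e : Fin n → Fin n → ℂ := fun i => Pi.single i 1
    -- Polarization: with E_ij the matrix units, the left side is (E_ij + E_ji) ⊗ b + i(E_ij - E_ji)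
    -- ⊗ c. The two scalar matrices are the rank one matrices of e_i + e_j and of e_i - i e_j, each
    -- minus E_ii and E_jj. The case i = j is included.
    have h1 : Matrix.single i j (b + Complex.I • c) + S.matStar (Matrix.single i j (b + Complex.I • c))
        = (rankOne (e i + e j) b + ((-1 : ℝ) : ℂ) • rankOne (e i) b
          + ((-1 : ℝ) : ℂ) • rankOne (e j) b)
        + (rankOne (e i - Complex.I • e j) c + ((-1 : ℝ) : ℂ) • rankOne (e i) c
          + ((-1 : ℝ) : ℂ) • rankOne (e j) c) := by
      have hs : ∀ (x : A) (k l : Fin n),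
          Matrix.single i j x k l = if k = i then (if l = j then x else 0) else 0 := by
        intro x k l
        rw [Matrix.single_apply, ← ite_and]
        simp only [eq_comm]
      ext k l
      simp only [Matrix.add_apply, Matrix.smul_apply, matStar, hs, rankOne, e, Pi.add_apply,
        Pi.sub_apply, Pi.smul_apply, Pi.single_apply, smul_eq_mul]
      split_ifs <;> simp [hb, hc, mul_add, sub_mul, add_smul, sub_smul] <;> module
    rw [h1]
    simp only [map_add, map_smul]
    have hR := fun (a : A) (ha : S.star a = a) (v : Fin n → ℂ) =>
      isHermitianFor_rankOne (n := n) hE ha v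
    exact (((hR b hb _).add ((hR b hb _).smul _)).add ((hR b hb _).smul _)).add
      (((hR c hc _).add ((hR c hc _).smul _)).add ((hR c hc _).smul _))

/-! ### The two inequalities between the given norms and the C*-norms -/

variable {E : OperatorSpaceStructure A}

theorem norm_le_matNorm (hE : E.groundNorm = S.norm)
    (hmul : ∀ (n : ℕ) (x y : Matrix (Fin n) (Fin n) A),
      E.norm n (S.matMul x y) ≤ E.norm n x * E.norm n y)
    {n : ℕ} (x : Matrix (Fin n) (Fin n) A) : E.norm n x ≤ S.canonical.norm n x := by
  have hsa : ∀ (m : ℕ) (y : Matrix (Fin m) (Fin m) A), S.matStar y = y →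
      E.norm m y ≤ S.canonical.norm m y := by
    intro m y hy
    refine seminorm_le_norm_of_isSelfAdjoint (p := S.matSeminorm E m) (matSeminorm_mul_le hmul)
      (M := m * m) (by positivity)
      (fun z => ?_) (fun h hh => ?_) (a := S.toMatAlg m y) (congrArg (S.toMatAlg m) hy)
    · obtain ⟨z, rfl⟩ := (S.toMatAlg m).surjective z
      exact E.norm_le_mul_norm (hE.trans S.groundNorm_canonical.symm) z
    -- A selfadjoint z equals (z + z*)/2.
    · obtain ⟨z, rfl⟩ := (S.toMatAlg m).surjective h
      have h1 := (isHermitianFor_add_star hE z).smul (1 / 2)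
      have h2 : S.matStar z = z := (S.toMatAlg m).injective hh
      rw [h2, ← map_smul] at h1
      convert h1 using 2
      push_cast
      module
  -- Exchanging the two column blocks of x ⊕ x* gives the selfadjoint matrix [[0, x], [x*, 0]]. Its
  -- C*-norm is at most that of x ⊕ x*, and it has x as its upper right corner.
  let y := sandwich (1 : Matrix (Fin (n + n)) (Fin (n + n)) ℂ) (dsum x (S.matStar x)) (incl (finAddFlip (m := n) (n := n)))
  have hinj : Function.Injective (finAddFlip (m := n) (n := n)) := Equiv.injective _
  have hy : ∀ i j, y i j = dsum x (S.matStar x) i (finAddFlip j) := fun i j => by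
    simp [y, sandwich, incl_apply, Matrix.one_apply]
  have h1 : S.matStar y = y := by
    ext i j
    simp only [matStar, hy]
    induction i using Fin.addCases <;> induction j using Fin.addCases <;>
      simp [dsum, matStar, S.star_star, -Fin.natAdd_eq_addNat]
  have h2 : x = sandwich (incl (Fin.castAdd n))ᵀ y (incl (Fin.natAdd n)) := by
    ext i j
    have : sandwich (incl (Fin.castAdd n))ᵀ y (incl (Fin.natAdd n)) i j
        = y (Fin.castAdd n i) (Fin.natAdd n j) := by
      simp [sandwich, incl_apply, -Fin.natAdd_eq_addNat]
    rw [this, hy]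
    simp [dsum, -Fin.natAdd_eq_addNat]
  have i1 := Fin.castAdd_injective n n
  have i2 := Fin.natAdd_injective n n
  calc E.norm n x ≤ E.norm (n + n) y := by
        conv_lhs => rw [h2]
        refine (E.norm_sandwich_le' _ _ _).trans ((mul_norm_mul_le (norm_nonneg _)
          (apply_nonneg _ _) (norm_nonneg _) (norm_incl_transpose_le i1)
          (norm_incl_le i2)).trans ?_)
        simp
    _ ≤ S.canonical.norm (n + n) y := hsa _ _ h1
    _ ≤ S.canonical.norm (n + n) (dsum x (S.matStar x)) := by
        refine (S.canonical.norm_sandwich_le _ _ _ _).trans ((mul_norm_mul_le (norm_nonneg _)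
          (apply_nonneg _ _) (norm_nonneg _) (norm_one_le _)
          (norm_incl_le hinj)).trans ?_)
        simp
    _ = S.canonical.norm n x := by
        rw [norm_dsum]
        refine max_eq_left (le_of_eq ?_)
        change ‖S.toMatAlg n (S.matStar x)‖ = ‖S.toMatAlg n x‖
        rw [toMatAlg_matStar, norm_star]

/-- For selfadjoint y, ‖y‖^(2^k) = ‖y^(2^k)‖ ≤ n² p(y)^(2^k) for all k, whence ‖y‖ ≤ p(y). Applying
this to y = x*x reaches a general x, and here contractivity of the adjoint on `M_n(A)` is needed. -/
theorem matNorm_le_norm (hE : E.groundNorm = S.norm)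
    (hmul : ∀ (n : ℕ) (x y : Matrix (Fin n) (Fin n) A),
      E.norm n (S.matMul x y) ≤ E.norm n x * E.norm n y)
    (hstar : ∀ (n : ℕ) (x : Matrix (Fin n) (Fin n) A), E.norm n (S.matStar x) ≤ E.norm n x)
    {n : ℕ} (x : Matrix (Fin n) (Fin n) A) : S.canonical.norm n x ≤ E.norm n x := by
  have hle : ∀ y : S.MatAlg n, ‖y‖ ≤ (n * n : ℝ) * S.matSeminorm E n y := fun y =>
    S.canonical.norm_le_mul_norm (S.groundNorm_canonical.trans hE.symm) ((S.toMatAlg n).symm y)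
  have hpow : ∀ (y : S.MatAlg n) (m : ℕ), m ≠ 0 →
      S.matSeminorm E n (y ^ m) ≤ S.matSeminorm E n y ^ m := fun y m hm =>
    seminorm_pow_le (p := S.matSeminorm E n) (matSeminorm_mul_le hmul) y hm
  have hsa : ∀ y : S.MatAlg n, IsSelfAdjoint y → ‖y‖ ≤ S.matSeminorm E n y := by
    intro y hy
    refine le_of_forall_pow_two_pow_le (M := n * n) (apply_nonneg _ _) fun k => ?_
    have h1 : ‖y ^ 2 ^ k‖ = ‖y‖ ^ 2 ^ k :=
      (congrArg NNReal.toReal (hy.nnnorm_pow_two_pow k)).trans (NNReal.coe_pow _ _)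
    have h2 : S.matSeminorm E n (y ^ 2 ^ k) ≤ S.matSeminorm E n y ^ 2 ^ k :=
      hpow y (2 ^ k) (pow_ne_zero k two_ne_zero)
    have h3 : ‖y ^ 2 ^ k‖ ≤ (n * n : ℝ) * S.matSeminorm E n (y ^ 2 ^ k) :=
      hle _
    rw [← h1]
    exact h3.trans (mul_le_mul_of_nonneg_left h2 (by positivity))
  have h1 := hsa (Star.star (S.toMatAlg n x) * S.toMatAlg n x) (.star_mul_self _)
  rw [CStarRing.norm_star_mul_self] at h1
  have h2 := (h1.trans (matSeminorm_mul_le hmul _ _)).trans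
    (mul_le_mul_of_nonneg_right (hstar n x) (apply_nonneg _ _))
  exact abs_le_of_sq_le_sq' (by rw [sq, sq]; exact h2) (apply_nonneg _ _) |>.2

theorem eq_canonical (hE : E.groundNorm = S.norm)
    (hmul : ∀ (n : ℕ) (x y : Matrix (Fin n) (Fin n) A),
      E.norm n (S.matMul x y) ≤ E.norm n x * E.norm n y)
    (hstar : ∀ (n : ℕ) (x : Matrix (Fin n) (Fin n) A), E.norm n (S.matStar x) ≤ E.norm n x) :
    E = S.canonical := by
  ext n x
  exact le_antisymm (norm_le_matNorm hE hmul x) (matNorm_le_norm hE hmul hstar x)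

end VNAlgebra

/-! ### From a monoid for the Haagerup tensor product to a C*-algebra -/

namespace HaagerupVNAlgebra

variable {A : Type u} [AddCommGroup A] [Module ℂ A] [FiniteDimensional ℂ A]
  (C : HaagerupVNAlgebra A)

/-- The pair x, y is one of the factorizations of x ⊙ y in the infimum, with inner size r = n. -/
theorem norm_matMul_le {n : ℕ} (x y : Matrix (Fin n) (Fin n) A) :
    C.oss.norm n (fun i j => ∑ k, C.mul (x i k ⊗ₜ[ℂ] y k j)) ≤ C.oss.norm n x * C.oss.norm n y := by
  have h := (C.mul_contraction n (matrixInner x y)).trans (haagerupNorm_le C.oss C.oss x y)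
  rw [rectNorm_square, rectNorm_square] at h
  have e : (matrixInner x y).map C.mul
      = (fun i j => ∑ k, C.mul (x i k ⊗ₜ[ℂ] y k j) : Matrix (Fin n) (Fin n) A) := by
    ext i j
    simp [matrixInner, map_sum]
  rwa [e] at h

theorem groundNorm_mul_le (a b : A) :
    C.oss.groundNorm (C.mul (a ⊗ₜ[ℂ] b)) ≤ C.oss.groundNorm a * C.oss.groundNorm b := by
  have h := C.norm_matMul_le (n := 1) (fun _ _ => a) (fun _ _ => b)
  refine le_trans (le_of_eq ?_) h
  change C.oss.norm 1 (fun _ _ => C.mul (a ⊗ₜ[ℂ] b)) = _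
  congr 1
  ext i j
  simp

/-- Condition 4 speaks of unit vectors only. Both sides are homogeneous of degree 2 in a, so a is
scaled by the inverse of its norm; for norm 0 submultiplicativity suffices. -/
theorem groundNorm_inv_mul_self (a : A) :
    C.oss.groundNorm (C.mul (C.inv (Conj.mk a) ⊗ₜ[ℂ] a)) = C.oss.groundNorm a ^ 2 := by
  rcases (apply_nonneg C.oss.groundNorm a).eq_or_lt with h0 | h0
  · refine le_antisymm ((C.groundNorm_mul_le _ _).trans ?_) ?_
    · simp [← h0]
    · rw [← h0]
      simp
  · set r := C.oss.groundNorm a with hr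
    have h1 := C.cstar_identity (LinearMap.toSpanSingleton ℂ A (((r⁻¹ : ℝ) : ℂ) • a)) (by
      rw [isCompleteIsometry_iff, LinearMap.toSpanSingleton_apply, one_smul, map_smul_eq_mul,
        Complex.norm_real, Real.norm_of_nonneg (by positivity), ← hr, inv_mul_cancel₀ h0.ne'])
    rw [isCompleteIsometry_iff, groundNorm_opp, starMulSelf_one, LinearMap.toSpanSingleton_apply,
      one_smul, map_smulₛₗ, map_smul, Complex.conj_ofReal, TensorProduct.smul_tmul_smul, map_smul,
      map_smul_eq_mul, ← Complex.ofReal_mul, Complex.norm_real,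
      Real.norm_of_nonneg (by positivity)] at h1
    field_simp at h1
    exact h1

/-- The von Neumann algebra underlying a categorical one. -/
def toVNAlgebra : VNAlgebra A where
  mul := TensorProduct.curry C.mul
  one := C.unit 1
  star := C.inv.comp Conj.mk
  norm := C.oss.groundNorm
  eq_zero_of_norm_eq_zero a h := congrFun (congrFun (C.oss.eq_zero_of_norm_eq_zero 1 _ h) 0) 0
  mul_assoc a b c := (LinearMap.congr_fun C.mul_assoc (a ⊗ₜ b ⊗ₜ c)).symm
  one_mul a := by simpa using LinearMap.congr_fun C.one_mul (1 ⊗ₜ a)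
  mul_one a := by simpa using LinearMap.congr_fun C.mul_one (a ⊗ₜ 1)
  star_star a := LinearMap.congr_fun C.involution a
  star_mul a b := LinearMap.congr_fun C.reverse_multiplicative (Conj.mk a ⊗ₜ Conj.mk b)
  norm_mul_le := C.groundNorm_mul_le
  norm_star_mul_self := C.groundNorm_inv_mul_self

theorem corresponds_toVNAlgebra : C.toVNAlgebra.Corresponds C where
  mul_eq _ _ := rfl
  unit_eq := rfl
  inv_eq _ := rfl
  norm_eq := rfl
  canonical := by
    have h : C.oss = C.toVNAlgebra.canonical :=
      VNAlgebra.eq_canonical rfl (fun _ => C.norm_matMul_le)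
        -- The transpose in the norm of `A_o` makes the amplification of i the adjoint of matrices.
        fun n x => C.inv_contraction n (x.map Conj.mk)
    rw [h]
    exact C.toVNAlgebra.isCanonical_canonical

end HaagerupVNAlgebra

end

end FdOS

theorem mainTheorem3 (A : Type*) [AddCommGroup A] [Module ℂ A] [FiniteDimensional ℂ A] :
    (∀ S : FdOS.VNAlgebra A, ∃! C : FdOS.HaagerupVNAlgebra A, S.Corresponds C) ∧
    (∀ C : FdOS.HaagerupVNAlgebra A, ∃! S : FdOS.VNAlgebra A, S.Corresponds C) :=
  ⟨fun S => ⟨S.toHaagerup, S.corresponds_toHaagerup, fun _ h => h.eq_toHaagerup⟩,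
    fun C => ⟨C.toVNAlgebra, C.corresponds_toVNAlgebra,
      fun _ h => h.eq C.corresponds_toVNAlgebra⟩⟩
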